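/- Let $\Gamma$ be a finitely generated group. An LCL problem on $\Gamma$ is a triple $\Pi = (W, \Lambda, \mathcal{A})$, where $W \subseteq \Gamma$ is a finite set, $\Lambda$ is a finite set of labels, and $\mathcal{A} \subseteq \Lambda^W$. For an action of $\Gamma$ on a set $X$, a solution to $\Pi$ on $X$ is a function $f \colon X \to \Lambda$ such that for every $x \in X$, the map $W \to \Lambda$, $w \mapsto f(w \cdot x)$, belongs to $\mathcal{A}$. An action is free if $\gamma \cdot x \neq x$ for all $x \in X$ and all nonidentity $\gamma \in \Gamma$. An action of $\Gamma$ on a computable set $X \subseteq \mathbb{N}$ is computable if for each $\gamma \in \Gamma$ the function $X \to X$, $x \mapsto \gamma \cdot x$, is computable. Let $\mathtt{COMPUTABLE}(\Gamma)$ be the class of all LCL problems $\Pi$ on $\Gamma$ such that every free computable action of $\Gamma$ on a computable set $X \subseteq \mathbb{N}$ has a computable solution $f \colon X \to \Lambda$ to $\Pi$. Let $\mathtt{BAIRE}(\Gamma)$ be the class of all LCL problems $\Pi$ on $\Gamma$ such that every free Borel action of $\Gamma$ on a Polish space $X$ has a Baire-measurable solution $f \colon X \to \Lambda$ to $\Pi$,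 where $\Lambda$ is equipped with the discrete topology. **Theorem.** For every integer $n \geq 2$, we have $\mathtt{COMPUTABLE}(\mathbb{Z}^n) \setminus \mathtt{BAIRE}(\mathbb{Z}^n) \neq \varnothing$. That is, there is an LCL problem on $\mathbb{Z}^n$ that has a computable solution on every free computable action of $\mathbb{Z}^n$ on a computable subset of $\mathbb{N}$, but that does not have a Baire-measurable solution on some free Borel action of $\mathbb{Z}^n$ on a Polish space. -/

import Mathlib

/-- A locally checkable labeling (LCL) problem on an (additively written) group `Γ`: a finite
window `W ⊆ Γ`, a finite set `Λ` of labels, and a family of allowed configurations `W → Λ`. -/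
structure LCLProblem (Γ : Type) where
  window : Finset Γ
  Label : Type
  finite_label : Finite Label
  allowed : Set (window → Label)

namespace LCLProblem

variable {Γ : Type} [AddGroup Γ]

/-- `f : X → Λ` is a solution to `P` on the action of `Γ` on `X` if for all `x`, the mapping
`w ↦ f (w · x)` on the window is an allowed configuration. -/
def IsSolution (P : LCLProblem Γ) {X : Type} [AddAction Γ X] (f : X → P.Label) : Prop :=
  ∀ x : X, (fun w : P.window => f ((w : Γ) +ᵥ x)) ∈ P.allowed

end LCLProblem

/-- An action is free if no nonidentity element of the group fixes a point. -/
def IsFreeAction (Γ X : Type) [AddGroup Γ] [AddAction Γ X] : Prop :=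
  ∀ (γ : Γ) (x : X), γ +ᵥ x = x → γ = 0

/-- A function `X → ℕ` on a computable set `X ⊆ ℕ` is computable if some algorithm computes its
values on `X`. As membership in `X` is decidable, the algorithm may be taken to halt everywhere. -/
def ComputableOn (X : Set ℕ) (f : X → ℕ) : Prop :=
  ∃ g : ℕ → ℕ, Computable g ∧ ∀ x : X, g x = f x

/-- An action on a computable set `X ⊆ ℕ` is computable if every group element acts by a computable
function `X → X`. -/
def IsComputableAction (Γ : Type) [AddGroup Γ] (X : Set ℕ) [AddAction Γ X] : Prop :=
  ∀ γ : Γ, ComputableOn X (fun x => ((γ +ᵥ x : X) : ℕ))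

/-- A labeling of `X ⊆ ℕ` by a finite set is computable if it is so after coding the labels by
distinct natural numbers (which coding is used does not matter, since there are finitely many
labels). -/
def IsComputableLabeling {X : Set ℕ} {L : Type} (f : X → L) : Prop :=
  ∃ e : L ↪ ℕ, ComputableOn X (fun x => e (f x))

/-- A map to a discrete space is Baire measurable if all preimages have the Baire property. -/
def IsBaireMeasurableLabeling {X L : Type} [TopologicalSpace X] (f : X → L) : Prop :=
  ∀ s : Set L, BaireMeasurableSet (f ⁻¹' s)

/-- The LCL problems that have a computable solution on every free computable action of `Γ` on a
computable set `X ⊆ ℕ`. -/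
def COMPUTABLE (Γ : Type) [AddGroup Γ] : Set (LCLProblem Γ) :=
  {P | ∀ (X : Set ℕ) [AddAction Γ X], ComputablePred (fun m : ℕ => m ∈ X) →
    IsFreeAction Γ X → IsComputableAction Γ X →
      ∃ f : X → P.Label, P.IsSolution f ∧ IsComputableLabeling f}

/-- The LCL problems that have a Baire-measurable solution on every free Borel action of the
countable discrete group `Γ` on a Polish space. -/
def BAIRE (Γ : Type) [AddGroup Γ] : Set (LCLProblem Γ) :=
  {P | ∀ (X : Type) [TopologicalSpace X] [PolishSpace X] [MeasurableSpace X] [BorelSpace X]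
    [AddAction Γ X], IsFreeAction Γ X → (∀ γ : Γ, Measurable (fun x : X => γ +ᵥ x)) →
      ∃ f : X → P.Label, P.IsSolution f ∧ IsBaireMeasurableLabeling f}

open Finset Filter Topology

/-! The problem asks for a two-colouring together with an injection moving points by at most 3 in
each coordinate of a copy of `ℤ²`, whose image avoids every defect: a point with the same colour as
its right neighbour. Solvability depends on how sparse the defects can be made.

Baire side. On the 3-adic odometer, a Baire-measurable colouring agrees with open sets along generic
orbits. Small balls are invariant under odd multiples of `ℤ²`, so colours cannot alternate along all
generic rows, and the defects contain a coset of some `qℤ²` in some orbit. This has positive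
density, while a bounded displacement gains room only along the boundary of a large square, so no
injection avoids it (`not_injective_of_avoids_lattice`, `escapeProblem_no_baire_solution`).

Computable side. A number takes its colour, by alternation, from the nearest smaller number in its
row within distance `x + 1`. Each defect then needs its own seed, a point with no smaller one in
range. An interval of a row holds at most one seed of large rank, and seeds of small rank are few
because ranks are distinct. So defects in a region number at most about its perimeter
(`card_changes_le`), which the isoperimetric gain from the `[-3, 3]²` box exceeds
(`card_add_perimeter_le`).

Hall's condition therefore holds with a surplus of order the perimeter. The surplus makes finite
matchings reliable: one defined on a large enough ball can be trusted near the centre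
(`exists_matching_extending`). With a computable radius, a search then builds a computable matching
(`exists_computable_matching`). -/

/-- The square `[-3, 3]²` of admissible displacements. -/
noncomputable def displacementBox : Finset (ℤ × ℤ) := Icc (-3) 3 ×ˢ Icc (-3) 3

theorem mem_displacementBox {s : ℤ × ℤ} :
    s ∈ displacementBox ↔ (-3 ≤ s.1 ∧ s.1 ≤ 3) ∧ (-3 ≤ s.2 ∧ s.2 ≤ 3) := by
  simp [displacementBox]

theorem neg_mem_displacementBox {s : ℤ × ℤ} (hs : s ∈ displacementBox) :
    -s ∈ displacementBox := by
  rw [mem_displacementBox] at *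
  simp only [Prod.fst_neg, Prod.snd_neg]
  omega

/-! ### The LCL problem and its global meaning. -/

section Problem

variable {Γ : Type} [AddGroup Γ]

open Classical in
/-- Given a homomorphism `φ : ℤ² → Γ`, label each point by a colour and a displacement in such a
way that moving every point by its displacement is injective, and no point `x` having the same
colour as `φ (1, 0) + x` is in the image of that map. -/
noncomputable def escapeProblem (φ : ℤ × ℤ →+ Γ) : LCLProblem Γ where
  window := displacementBox.image φ
  Label := Bool × displacementBox
  finite_label := inferInstance
  allowed := {p |
    (∀ (s t : displacementBox) (w z : displacementBox.image φ), (w : Γ) = φ (-(s : ℤ × ℤ)) →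
      (z : Γ) = φ (-(t : ℤ × ℤ)) → (p w).2 = s → (p z).2 = t → s = t) ∧
    ∀ (s : displacementBox) (w o e : displacementBox.image φ), (w : Γ) = φ (-(s : ℤ × ℤ)) →
      (o : Γ) = 0 → (e : Γ) = φ (1, 0) → (p w).2 = s → (p e).1 ≠ (p o).1}

/-- The local rule is read at the landing point: only the points `φ (-s) +ᵥ x` labelled `s` can land
on `x`, so a finite window sees every potential collision and whether `x` is a defect. -/
theorem escapeProblem_isSolution_iff (φ : ℤ × ℤ →+ Γ) {X : Type} [AddAction Γ X]
    (c : X → Bool) (v : X → displacementBox) :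
    (escapeProblem φ).IsSolution (fun x => ((c x, v x) : Bool × displacementBox)) ↔
      Function.Injective (fun x => φ (v x) +ᵥ x) ∧
        ∀ x, c (φ (1, 0) +ᵥ (φ (v x) +ᵥ x)) ≠ c (φ (v x) +ᵥ x) := by
  classical
  have hneg : ∀ (s : ℤ × ℤ) (x : X), φ (-s) +ᵥ (φ s +ᵥ x) = x := by
    intro s x; rw [map_neg, neg_vadd_vadd]
  have hneg' : ∀ (s : ℤ × ℤ) (x : X), φ s +ᵥ (φ (-s) +ᵥ x) = x := by
    intro s x; rw [map_neg, vadd_neg_vadd]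
  have hwin : ∀ s ∈ displacementBox, φ s ∈ displacementBox.image φ :=
    fun s hs => mem_image_of_mem _ hs
  have h0 : (0 : Γ) ∈ displacementBox.image φ := by
    simpa using hwin 0 (by simp [mem_displacementBox])
  have h1 := hwin (1, 0) (by simp [mem_displacementBox])
  constructor
  · intro h
    refine ⟨fun x y hxy => ?_, fun x => ?_⟩
    · have hst := (h (φ (v x) +ᵥ x)).1 (v x) (v y) ⟨_, hwin _ (neg_mem_displacementBox (v x).2)⟩
        ⟨_, hwin _ (neg_mem_displacementBox (v y).2)⟩ rfl rfl
      have hxy' : φ (v x) +ᵥ x = φ (v y) +ᵥ y := hxy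
      have := hst (by simp only [hneg]) (by simp only [hxy', hneg])
      rw [this] at hxy'
      exact AddAction.injective _ hxy'
    · have := (h (φ (v x) +ᵥ x)).2 (v x) ⟨_, hwin _ (neg_mem_displacementBox (v x).2)⟩ ⟨0, h0⟩
        ⟨_, h1⟩ rfl rfl rfl (by simp only [hneg])
      simpa using this
  · rintro ⟨hinj, hdef⟩ x
    refine ⟨?_, ?_⟩
    · rintro s t ⟨w, hw⟩ ⟨z, hz⟩ rfl rfl hs ht
      dsimp only at hs ht
      have h2 : φ (-(s : ℤ × ℤ)) +ᵥ x = φ (-(t : ℤ × ℤ)) +ᵥ x := by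
        apply hinj
        simp only [hs, ht, hneg']
      rw [← hs, ← ht, h2]
    · rintro s ⟨w, hw⟩ ⟨o, ho⟩ ⟨e, he⟩ rfl rfl rfl hs
      have := hdef (φ (-(s : ℤ × ℤ)) +ᵥ x)
      dsimp only at hs ⊢
      rw [hs, hneg'] at this
      simpa using this

end Problem

/-! ### Density obstruction in the plane. -/

/-- A perturbation of the identity of `ℤ²` by displacements in the box which avoids a sublattice
of finite index is not injective. -/
theorem not_injective_of_avoids_lattice (d : ℤ × ℤ → ℤ × ℤ) (hd : ∀ u, d u ∈ displacementBox)
    (q : ℕ) (hq : 0 < q) (havoid : ∀ u w : ℤ × ℤ, u + d u ≠ (q : ℤ) • w) :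
    ¬ Function.Injective (fun u => u + d u) := by
  intro hinj
  -- Enlarging the square of side `q * m` by 3 on each side adds `12 * q * m + 36` points, fewer
  -- than the `m * m = 12 * q * m + 7 * m` lattice points to be avoided.
  obtain ⟨m, hm⟩ : ∃ m : ℕ, m = 12 * q + 7 := ⟨_, rfl⟩
  let B : Finset (ℤ × ℤ) := Ico 0 ((q * m : ℕ) : ℤ) ×ˢ Ico 0 ((q * m : ℕ) : ℤ)
  let C : Finset (ℤ × ℤ) := Ico (-3) ((q * m : ℕ) + 3 : ℤ) ×ˢ Ico (-3) ((q * m : ℕ) + 3 : ℤ)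
  let E : Finset (ℤ × ℤ) := (Ico 0 (m : ℤ) ×ˢ Ico 0 (m : ℤ)).image (fun w => (q : ℤ) • w)
  have hB : B.card = (q * m) * (q * m) := by
    simp only [B, card_product, Int.card_Ico, sub_zero, Int.toNat_natCast]
  have hC : C.card = (q * m + 6) * (q * m + 6) := by
    have : ((q * m : ℕ) + 3 - (-3) : ℤ) = ((q * m + 6 : ℕ) : ℤ) := by push_cast; ring
    simp only [C, card_product, Int.card_Ico, this, Int.toNat_natCast]
  have hqz : (q : ℤ) ≠ 0 := by exact_mod_cast hq.ne'
  have hE : E.card = m * m := by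
    rw [card_image_of_injective]
    · simp
    · exact fun a b h => smul_right_injective _ hqz h
  have hdisj : Disjoint (B.image (fun u => u + d u)) E := by
    rw [Finset.disjoint_left]
    intro z hz hz'
    obtain ⟨u, -, rfl⟩ := mem_image.1 hz
    obtain ⟨w, -, hw⟩ := mem_image.1 hz'
    exact havoid u w hw.symm
  have hsub : B.image (fun u => u + d u) ∪ E ⊆ C := by
    intro z hz
    rcases mem_union.1 hz with hz | hz
    · obtain ⟨u, hu, rfl⟩ := mem_image.1 hz
      have := mem_displacementBox.1 (hd u)
      simp only [B, C, mem_product, mem_Ico, Prod.fst_add, Prod.snd_add] at hu ⊢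
      omega
    · obtain ⟨w, hw, rfl⟩ := mem_image.1 hz
      simp only [C, mem_product, mem_Ico, Prod.smul_fst, Prod.smul_snd, smul_eq_mul] at hw ⊢
      have hq' : (0 : ℤ) < q := by exact_mod_cast hq
      push_cast
      refine ⟨⟨?_, ?_⟩, ⟨?_, ?_⟩⟩ <;> nlinarith
  have := card_le_card hsub
  rw [card_union_of_disjoint hdisj, card_image_of_injective _ hinj, hB, hC, hE] at this
  nlinarith

/-! ### No Baire-measurable solution: the category argument. -/

section Baire

variable {Γ : Type} [AddGroup Γ] {X : Type} [TopologicalSpace X] [AddAction Γ X]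

theorem residual_vadd (hcont : ∀ γ : Γ, Continuous (fun x : X => γ +ᵥ x)) {s : Set X}
    (hs : s ∈ residual X) (γ : Γ) : {x | γ +ᵥ x ∈ s} ∈ residual X := by
  refine tendsto_residual_of_isOpenMap (hcont γ) ?_ hs
  intro U hU
  have : (fun x : X => γ +ᵥ x) '' U = (fun x : X => (-γ) +ᵥ x) ⁻¹' U := by
    ext x
    constructor
    · rintro ⟨y, hy, rfl⟩; simpa using hy
    · intro hx; exact ⟨_, hx, by simp⟩
  rw [this]
  exact hU.preimage (hcont _)

/-- The escape problem has no Baire-measurable solution on an action by homeomorphisms in which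
every nonempty open set contains a nonempty open set that is invariant under an odd multiple of
`ℤ²`. -/
theorem escapeProblem_no_baire_solution [Countable Γ] [BaireSpace X] [Nonempty X]
    (φ : ℤ × ℤ →+ Γ)
    (hcont : ∀ γ : Γ, Continuous (fun x : X => γ +ᵥ x))
    (hfree : ∀ (u : ℤ × ℤ) (x : X), φ u +ᵥ x = x → u = 0)
    (hinv : ∀ U : Set X, IsOpen U → U.Nonempty → ∃ V ⊆ U, IsOpen V ∧ V.Nonempty ∧
      ∃ q : ℕ, Odd q ∧ ∀ (w : ℤ × ℤ), ∀ x ∈ V, φ ((q : ℤ) • w) +ᵥ x ∈ V)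
    (c : X → Bool) (v : X → displacementBox)
    (hsol : (escapeProblem φ).IsSolution (fun x => ((c x, v x) : Bool × displacementBox)))
    (hc : ∀ b : Bool, BaireMeasurableSet (c ⁻¹' {b})) : False := by
  rw [escapeProblem_isSolution_iff] at hsol
  obtain ⟨hinj, hdef⟩ := hsol
  -- Each colour class is open up to a meagre set. As `Γ` is countable, generic points see the open
  -- versions along their whole orbit.
  choose O hO hOeq using fun b => (hc b).residualEq_isOpen
  have hgood : {x : X | ∀ (γ : Γ) (b : Bool), c (γ +ᵥ x) = b ↔ γ +ᵥ x ∈ O b} ∈ residual X := by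
    have h1 : ∀ b, {x : X | c x = b ↔ x ∈ O b} ∈ residual X := fun b => by
      filter_upwards [hOeq b] with x hx
      have hx' : (c x = b) = (x ∈ O b) := hx
      exact iff_of_eq hx'
    have : ∀ᶠ x in residual X, ∀ (γ : Γ) (b : Bool), c (γ +ᵥ x) = b ↔ γ +ᵥ x ∈ O b := by
      rw [eventually_countable_forall]
      intro γ
      rw [eventually_countable_forall]
      intro b
      exact residual_vadd hcont (h1 b) γ
    exact this
  have hdense := dense_of_mem_residual hgood
  have hmain : ∀ U : Set X, IsOpen U → U.Nonempty → ∃ q : ℕ, Odd q ∧ ∃ y : X,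
      (∀ (γ : Γ) (b : Bool), c (γ +ᵥ y) = b ↔ γ +ᵥ y ∈ O b) ∧
      ∀ w : ℤ × ℤ, φ ((q : ℤ) • w) +ᵥ y ∈ U := by
    intro U hU hne
    obtain ⟨V, hVU, hV, hVne, q, hq, hqV⟩ := hinv U hU hne
    obtain ⟨y, hyV, hy⟩ := hdense.inter_open_nonempty V hV hVne
    exact ⟨q, hq, y, hy, fun w => hVU (hqV w y hyV)⟩
  -- The open set on which generic points are monochromatic with their successors.
  let D : Set X := ⋃ b, O b ∩ (fun x => φ (1, 0) +ᵥ x) ⁻¹' O b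
  have hD : IsOpen D := isOpen_iUnion fun b => (hO b).inter ((hO b).preimage (hcont _))
  have hDne : D.Nonempty := by
    by_contra hempty
    obtain ⟨x, hx⟩ := hdense.nonempty
    have hxO : x ∈ O (c x) := by simpa using (hx 0 (c x)).1 (by simp)
    -- Without defects, colours alternate along the row of `y`. But `y` and its translate by the odd
    -- number `q` both lie in `O (c x)`, hence share a colour.
    obtain ⟨q, hq, y, hy, hyq⟩ := hmain (O (c x)) (hO _) ⟨x, hxO⟩
    have halt : ∀ γ : Γ, c (φ (1, 0) +ᵥ (γ +ᵥ y)) = !c (γ +ᵥ y) := by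
      intro γ
      by_contra hne
      have heq : c (φ (1, 0) +ᵥ (γ +ᵥ y)) = c (γ +ᵥ y) := by
        revert hne; cases c (φ (1, 0) +ᵥ (γ +ᵥ y)) <;> cases c (γ +ᵥ y) <;> simp
      refine hempty ⟨γ +ᵥ y, Set.mem_iUnion.2 ⟨c (γ +ᵥ y), (hy γ _).1 rfl, ?_⟩⟩
      have := (hy (φ (1, 0) + γ) (c (γ +ᵥ y))).1 (by rw [add_vadd, heq])
      rwa [add_vadd] at this
    have hpar : ∀ k : ℕ, c (φ ((k : ℤ), 0) +ᵥ y) = xor (c y) k.bodd := by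
      intro k
      induction k with
      | zero =>
        have h00 : φ (((0 : ℕ) : ℤ), 0) = 0 := by
          rw [show (((0 : ℕ) : ℤ), (0 : ℤ)) = 0 from rfl, map_zero]
        rw [h00]; simp
      | succ k ih =>
        have : (((k + 1 : ℕ) : ℤ), (0 : ℤ)) = (1, 0) + ((k : ℤ), 0) := by
          ext <;> simp [add_comm]
        rw [this, map_add, add_vadd, halt, ih]
        cases c y <;> cases hk : k.bodd <;> simp [Nat.bodd_succ, hk]
    have e0 : c y = c x := by simpa using (hy 0 (c x)).2 (by simpa using hyq 0)
    have e1 := (hy _ (c x)).2 (hyq (1, 0))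
    have : (q : ℤ) • ((1 : ℤ), (0 : ℤ)) = ((q : ℤ), 0) := by simp
    rw [this, hpar, e0] at e1
    have hb : q.bodd = true := by
      obtain ⟨m, rfl⟩ := hq; simp [Nat.bodd_two]
    rw [hb] at e1
    revert e1; cases c x <;> simp
  obtain ⟨q, hq, y, hy, hyq⟩ := hmain D hD hDne
  have hmono : ∀ w : ℤ × ℤ, c (φ (1, 0) +ᵥ (φ ((q : ℤ) • w) +ᵥ y)) = c (φ ((q : ℤ) • w) +ᵥ y) := by
    intro w
    obtain ⟨b, hb1, hb2⟩ := Set.mem_iUnion.1 (hyq w)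
    rw [(hy _ b).2 hb1]
    have := (hy (φ (1, 0) + φ ((q : ℤ) • w)) b).2 (by rw [add_vadd]; exact hb2)
    rwa [add_vadd] at this
  refine not_injective_of_avoids_lattice (fun u => v (φ u +ᵥ y)) (fun u => (v _).2) q hq.pos ?_ ?_
  · intro u w huw
    apply hdef (φ u +ᵥ y)
    rw [← add_vadd (φ _) (φ u), ← map_add, add_comm (_ : ℤ × ℤ) u, huw]
    exact hmono w
  · intro u u' h
    have h1 : φ u +ᵥ y = φ u' +ᵥ y := by
      apply hinj
      simp only [← add_vadd, ← map_add]
      have h' : u + (v (φ u +ᵥ y) : ℤ × ℤ) = u' + (v (φ u' +ᵥ y) : ℤ × ℤ) := h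
      rw [add_comm _ u, add_comm _ u', h']
    have h2 : φ (-u' + u) +ᵥ y = y := by
      rw [map_add, add_vadd, h1, ← add_vadd, ← map_add]; simp
    have := hfree _ _ h2
    exact (neg_add_eq_zero.1 this).symm

end Baire

/-! ### The 3-adic odometer. -/

section Odometer

/-- The action of `ℤⁿ` on `(ℤ₃)ⁿ` by translations. -/
noncomputable abbrev odometerAction (n : ℕ) : AddAction (Fin n → ℤ) (Fin n → ℤ_[3]) where
  vadd γ x := fun i => (γ i : ℤ_[3]) + x i
  zero_vadd x := by ext i; simp [HVAdd.hVAdd]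
  add_vadd γ δ x := by ext i; simp [HVAdd.hVAdd, add_assoc]

attribute [local instance] odometerAction

theorem odometer_vadd_apply {n : ℕ} (γ : Fin n → ℤ) (x : Fin n → ℤ_[3]) (i : Fin n) :
    (γ +ᵥ x) i = (γ i : ℤ_[3]) + x i := rfl

theorem odometer_isFreeAction (n : ℕ) : IsFreeAction (Fin n → ℤ) (Fin n → ℤ_[3]) := by
  intro γ x h
  ext i
  have := congrFun h i
  rw [odometer_vadd_apply] at this
  simpa using this

theorem odometer_continuous {n : ℕ} (γ : Fin n → ℤ) :
    Continuous (fun x : Fin n → ℤ_[3] => γ +ᵥ x) := by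
  refine continuous_pi fun i => ?_
  simp only [odometer_vadd_apply]
  fun_prop

/-- By the ultrametric inequality, a ball is invariant under translations smaller than its radius,
so high powers of 3 suffice. The prime 3 is used because its powers are odd. -/
theorem odometer_exists_invariant_open {n : ℕ} (φ : ℤ × ℤ →+ (Fin n → ℤ))
    (U : Set (Fin n → ℤ_[3])) (hU : IsOpen U) (hne : U.Nonempty) :
    ∃ V ⊆ U, IsOpen V ∧ V.Nonempty ∧
      ∃ q : ℕ, Odd q ∧ ∀ (w : ℤ × ℤ), ∀ x ∈ V, φ ((q : ℤ) • w) +ᵥ x ∈ V := by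
  obtain ⟨y, hy⟩ := hne
  obtain ⟨ε, hε, hball⟩ := Metric.isOpen_iff.1 hU y hy
  obtain ⟨k, hk⟩ := exists_pow_lt_of_lt_one hε (by norm_num : (1 / 3 : ℝ) < 1)
  refine ⟨Metric.ball y ε, hball, Metric.isOpen_ball, ⟨y, Metric.mem_ball_self hε⟩, 3 ^ k,
    Odd.pow (by decide), fun w x hx => ?_⟩
  rw [Metric.mem_ball, dist_pi_lt_iff hε] at hx ⊢
  intro i
  have hxi := hx i
  rw [dist_eq_norm] at hxi ⊢
  rw [odometer_vadd_apply, map_zsmul, Pi.smul_apply, add_sub_assoc]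
  refine lt_of_le_of_lt (PadicInt.nonarchimedean _ _) (max_lt ?_ hxi)
  refine lt_of_le_of_lt ?_ hk
  push_cast
  rw [smul_eq_mul, Int.cast_mul, norm_mul]
  have h1 : ‖(((3 ^ k : ℤ)) : ℤ_[3])‖ = (1 / 3) ^ k := by
    push_cast
    rw [norm_pow]
    congr 1
    have := PadicInt.norm_p (p := 3)
    simpa using this
  calc _ ≤ (1 / 3 : ℝ) ^ k * 1 := by
        rw [h1]
        exact mul_le_mul_of_nonneg_left (PadicInt.norm_le_one _) (by positivity)
    _ = _ := mul_one _

theorem escapeProblem_notMem_BAIRE {n : ℕ} (φ : ℤ × ℤ →+ (Fin n → ℤ))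
    (hφ : Function.Injective φ) : escapeProblem φ ∉ BAIRE (Fin n → ℤ) := by
  intro h
  let _ : MeasurableSpace (Fin n → ℤ_[3]) := borel _
  have : BorelSpace (Fin n → ℤ_[3]) := ⟨rfl⟩
  obtain ⟨f, hf, hB⟩ := h (Fin n → ℤ_[3]) (odometer_isFreeAction n)
    (fun γ => (odometer_continuous γ).measurable)
  refine escapeProblem_no_baire_solution φ odometer_continuous ?_
    (odometer_exists_invariant_open φ) (fun x => (f x : Bool × displacementBox).1)
    (fun x => (f x : Bool × displacementBox).2) hf ?_
  · intro u x hu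
    exact (map_eq_zero_iff φ hφ).1 (odometer_isFreeAction n _ _ hu)
  · intro b
    exact hB {l | (l : Bool × displacementBox).1 = b}

end Odometer

/-! ### Counting colour changes in a single row. -/

section Row

/-- A `ℤ`-indexed colouring `χ` follows the nearest-smaller rule with respect to `rank` if every
`i` either minimizes `rank` within distance `rank i + 1` or has the colour of a nearest point of
smaller rank, which is within that distance. -/
def FollowsNearestSmaller (rank : ℤ → ℕ) (χ : ℤ → Bool) : Prop :=
  ∀ i, (∀ k, |k - i| ≤ (rank i : ℤ) + 1 → rank i ≤ rank k) ∨
    ∃ k, |k - i| ≤ (rank i : ℤ) + 1 ∧ rank k < rank i ∧ χ i = χ k ∧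
      ∀ l, |l - i| < |k - i| → rank i ≤ rank l

variable {rank : ℤ → ℕ} {χ : ℤ → Bool}

/-- Induction on rank: an interior point sees `u` or `v` in its range, so it is not a seed. Its
nearest smaller point is no farther than either endpoint and so lies in `[u, v]`. -/
theorem FollowsNearestSmaller.eq_of_mem_arc (h : FollowsNearestSmaller rank χ) {u v : ℤ}
    (huv : χ u = χ v)
    (hin : ∀ z, u < z → z < v → rank u < rank z ∧ rank v < rank z ∧ v - u ≤ rank z + 1) :
    ∀ z, u ≤ z → z ≤ v → χ z = χ u := by
  suffices H : ∀ m z, rank z = m → u ≤ z → z ≤ v → χ z = χ u from fun z => H _ z rfl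
  intro m
  induction m using Nat.strong_induction_on with
  | _ m ih =>
    intro z hz huz hzv
    rcases huz.eq_or_lt with rfl | huz'
    · rfl
    rcases hzv.eq_or_lt with rfl | hzv'
    · exact huv.symm
    obtain ⟨hu, hv, hd⟩ := hin z huz' hzv'
    rcases h z with hs | ⟨k, hk, hkz, hχ, hnear⟩
    · exact absurd (hs u (by rw [abs_of_neg (by omega)]; omega)) (by omega)
    · have h1 : ¬ |u - z| < |k - z| := fun hlt => absurd (hnear u hlt) (by omega)
      have h2 : ¬ |v - z| < |k - z| := fun hlt => absurd (hnear v hlt) (by omega)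
      rw [abs_of_neg (by omega)] at h1
      rw [abs_of_pos (by omega)] at h2
      rw [hχ]
      have := neg_abs_le (k - z)
      have := le_abs_self (k - z)
      exact ih (rank k) (by omega) k rfl (by omega) (by omega)

/-- Between two colour changes there is a point that minimizes the rank in its range. -/
theorem FollowsNearestSmaller.exists_seed (h : FollowsNearestSmaller rank χ)
    (hinj : Function.Injective rank) {d e : ℤ} (hde : d < e) (hd : χ d ≠ χ (d + 1))
    (he : χ e ≠ χ (e + 1)) :
    ∃ i, d < i ∧ i ≤ e ∧ ∀ k, |k - i| ≤ (rank i : ℤ) + 1 → rank i ≤ rank k := by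
  obtain ⟨i, hi, hmin⟩ := exists_min_image (Ioc d e) rank ⟨e, by simp [hde]⟩
  rw [mem_Ioc] at hi
  refine ⟨i, hi.1, hi.2, ?_⟩
  rcases h i with hs | ⟨k, hk, hki, hχ, hnear⟩
  · exact hs
  · exfalso
    -- The rank-minimal point `i` copies from some `k` outside `(d, e]`. The arc between them is
    -- constant, yet it contains `d, d + 1` or `e, e + 1`.
    have hk' : k ∉ Ioc d e := fun hmem => absurd (hmin k hmem) (by omega)
    rw [mem_Ioc, not_and_or, not_lt, not_le] at hk'
    rcases hk' with hk' | hk'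
    · have harc := h.eq_of_mem_arc hχ.symm (fun z hz1 hz2 => by
        have h1 := hnear z (by rw [abs_of_neg (by omega), abs_of_neg (by omega)]; omega)
        have h2 : rank i ≠ rank z := fun hh => by have := hinj hh; omega
        rw [abs_of_neg (by omega)] at hk
        refine ⟨by omega, by omega, by omega⟩)
      exact hd ((harc d hk' (by omega)).trans (harc (d + 1) (by omega) (by omega)).symm)
    · have harc := h.eq_of_mem_arc hχ (fun z hz1 hz2 => by
        have h1 := hnear z (by rw [abs_of_pos (by omega), abs_of_pos (by omega)]; omega)
        have h2 : rank i ≠ rank z := fun hh => by have := hinj hh; omega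
        rw [abs_of_pos (by omega)] at hk
        refine ⟨by omega, by omega, by omega⟩)
      exact he ((harc e (by omega) (by omega)).trans (harc (e + 1) (by omega) (by omega)).symm)

/-- Seeds separate consecutive changes. Two seeds of rank at least `b - a` would lie in each other's
range, and each would have the smaller rank. -/
theorem FollowsNearestSmaller.card_changes_le (h : FollowsNearestSmaller rank χ)
    (hinj : Function.Injective rank) (a b : ℤ) :
    #{i ∈ Icc a b | χ i ≠ χ (i + 1)} ≤ 2 + #{i ∈ Icc a b | (rank i : ℤ) < b - a} := by
  classical
  set D := {i ∈ Icc a b | χ i ≠ χ (i + 1)}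
  set E := {i ∈ Icc a b | ∀ k, |k - i| ≤ (rank i : ℤ) + 1 → rank i ≤ rank k}
  have h1 : #D ≤ #E + 1 := by
    -- A seed may coincide with the right-hand change `e`. Sending changes to `2 * i` and seeds to
    -- `2 * i - 1` makes the interleaving strict.
    have hinj1 : Function.Injective (fun i : ℤ => 2 * i) := fun x y hxy => by
      have : 2 * x = 2 * y := hxy
      omega
    have hinj2 : Function.Injective (fun i : ℤ => 2 * i - 1) := fun x y hxy => by
      have : 2 * x - 1 = 2 * y - 1 := hxy
      omega
    rw [← card_image_of_injective D hinj1, ← card_image_of_injective E hinj2]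
    apply card_le_of_interleaved
    intro x hx y hy hxy _
    obtain ⟨d, hd, rfl⟩ := mem_image.1 hx
    obtain ⟨e, he, rfl⟩ := mem_image.1 hy
    simp only [D, mem_filter, mem_Icc] at hd he
    obtain ⟨i, hi1, hi2, hi3⟩ := h.exists_seed hinj (by omega : d < e) hd.2 he.2
    refine ⟨_, mem_image_of_mem _ (mem_filter.2 ⟨mem_Icc.2 ⟨by omega, by omega⟩, hi3⟩), ?_, ?_⟩
    · omega
    · omega
  have h2 : E ⊆ {i ∈ E | b - a ≤ rank i} ∪ {i ∈ Icc a b | (rank i : ℤ) < b - a} := by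
    intro i hi
    by_cases hc : b - a ≤ rank i
    · exact mem_union_left _ (mem_filter.2 ⟨hi, hc⟩)
    · exact mem_union_right _ (mem_filter.2 ⟨(mem_filter.1 hi).1, by omega⟩)
  have h3 : #{i ∈ E | b - a ≤ rank i} ≤ 1 := by
    rw [card_le_one]
    intro i hi k hk
    simp only [E, mem_filter, mem_Icc] at hi hk
    have hik := hi.1.2 k (by rw [abs_le]; omega)
    have hki := hk.1.2 i (by rw [abs_le]; omega)
    exact hinj (by omega)
  have h4 := card_le_card h2
  have h5 := card_union_le {i ∈ E | b - a ≤ rank i} {i ∈ Icc a b | (rank i : ℤ) < b - a}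
  omega

end Row

/-! ### Isoperimetry for sums with the box. -/

section Isoperimetry

open scoped Pointwise

/-- Row by row: each row of the sumset contains a nonempty row of `A`, no smaller than the one at
the same height, plus `[-3, 3]`. By Cauchy–Davenport in `ℤ` this adds at least 6 points. -/
theorem card_add_rows_le_card_add_displacementBox (A : Finset (ℤ × ℤ)) :
    #A + 6 * #((A + displacementBox).image Prod.snd) ≤ #(A + displacementBox) := by
  classical
  set C := A + displacementBox
  have hAC : ∀ z ∈ A, z.2 ∈ C.image Prod.snd := fun z hz =>
    mem_image_of_mem _ (mem_add.2 ⟨z, hz, 0, by simp [mem_displacementBox], add_zero z⟩)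
  rw [card_eq_sum_card_fiberwise hAC, card_eq_sum_card_image Prod.snd C, mul_comm, ← smul_eq_mul,
    ← sum_const, ← sum_add_distrib]
  refine sum_le_sum fun j hj => ?_
  obtain ⟨k, hk1, hk2, hk3⟩ : ∃ k, |j - k| ≤ 3 ∧ {z ∈ A | z.2 = k}.Nonempty ∧
      #{z ∈ A | z.2 = j} ≤ #{z ∈ A | z.2 = k} := by
    by_cases hne : {z ∈ A | z.2 = j}.Nonempty
    · exact ⟨j, by simp, hne, le_rfl⟩
    · obtain ⟨z, hz, rfl⟩ := mem_image.1 hj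
      obtain ⟨x, hx, s, hs, rfl⟩ := mem_add.1 hz
      have := mem_displacementBox.1 hs
      refine ⟨x.2, ?_, ⟨x, by simp [hx]⟩, ?_⟩
      · rw [Prod.snd_add, abs_le]; omega
      · rw [not_nonempty_iff_eq_empty.1 hne]; simp
  set B := {z ∈ A | z.2 = k}.image Prod.fst
  have hB : #B = #{z ∈ A | z.2 = k} := by
    refine card_image_of_injOn fun x hx y hy hxy => ?_
    simp only [coe_filter, Set.mem_ofPred_eq] at hx hy
    exact Prod.ext hxy (hx.2.trans hy.2.symm)
  have hcd := cauchy_davenport_add_of_linearOrder_isCancelAdd (s := B) (t := Icc (-3 : ℤ) 3)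
    (hk2.image _) ⟨0, by simp⟩
  have h7 : #(Icc (-3 : ℤ) 3) = 7 := by simp
  have hsub : (B + Icc (-3 : ℤ) 3).image (fun i => (i, j)) ⊆ {z ∈ C | z.2 = j} := by
    intro z hz
    obtain ⟨i, hi, rfl⟩ := mem_image.1 hz
    obtain ⟨x, hx, s, hs, rfl⟩ := mem_add.1 hi
    obtain ⟨y, hy, rfl⟩ := mem_image.1 hx
    rw [mem_filter] at hy ⊢
    refine ⟨mem_add.2 ⟨y, hy.1, (s, j - k), ?_, ?_⟩, rfl⟩
    · rw [mem_displacementBox]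
      exact ⟨mem_Icc.1 hs, abs_le.1 hk1⟩
    · ext
      · simp
      · simp [hy.2]
  have h8 := card_le_card hsub
  rw [card_image_of_injective _ (fun x y hxy => (Prod.ext_iff.1 hxy).1)] at h8
  omega

theorem card_add_cols_le_card_add_displacementBox (A : Finset (ℤ × ℤ)) :
    #A + 6 * #((A + displacementBox).image Prod.fst) ≤ #(A + displacementBox) := by
  classical
  have h := card_add_rows_le_card_add_displacementBox (A.image Prod.swap)
  have hS : displacementBox.image Prod.swap = displacementBox := by
    ext ⟨x, y⟩
    simp [mem_displacementBox, and_comm]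
  have hsum : A.image Prod.swap + displacementBox = (A + displacementBox).image Prod.swap := by
    conv_lhs => rw [← hS]
    exact (image_add (AddEquiv.prodComm : ℤ × ℤ ≃+ ℤ × ℤ)).symm
  rw [hsum, card_image_of_injective _ Prod.swap_injective,
    card_image_of_injective _ Prod.swap_injective, image_image] at h
  exact h

/-- If the rows of a colouring follow the nearest-smaller rule, then the points at which the
colour does not change outnumber any column-connected set by its perimeter. -/
theorem card_add_perimeter_le {rank : ℤ × ℤ → ℕ} {χ : ℤ × ℤ → Bool}
    (hinj : Function.Injective rank)
    (hrow : ∀ j, FollowsNearestSmaller (fun i => rank (i, j)) (fun i => χ (i, j)))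
    (A : Finset (ℤ × ℤ)) {a b : ℤ} (hab : ∀ z ∈ A + displacementBox, a ≤ z.1 ∧ z.1 ≤ b)
    (hcard : b - a + 1 ≤ #((A + displacementBox).image Prod.fst)) :
    #A + #((A + displacementBox).image Prod.snd) + #((A + displacementBox).image Prod.fst) ≤
      #{z ∈ A + displacementBox | χ z = χ (z.1 + 1, z.2)} := by
  classical
  have h1 := card_add_rows_le_card_add_displacementBox A
  have h2 := card_add_cols_le_card_add_displacementBox A
  set C := A + displacementBox
  have h3 : #{z ∈ C | χ z = χ (z.1 + 1, z.2)} + #{z ∈ C | ¬ χ z = χ (z.1 + 1, z.2)} = #C :=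
    card_filter_add_card_filter_not _
  have h4 : #{z ∈ C | ¬ χ z = χ (z.1 + 1, z.2)} ≤
      ∑ j ∈ C.image Prod.snd, (2 + #{i ∈ Icc a b | (rank (i, j) : ℤ) < b - a}) := by
    rw [card_eq_sum_card_fiberwise (f := Prod.snd) (t := C.image Prod.snd)
      (fun z hz => mem_coe.2 (mem_image_of_mem _ (mem_filter.1 hz).1))]
    refine sum_le_sum fun j _ => le_trans ?_
      ((hrow j).card_changes_le (fun x y hxy => (Prod.ext_iff.1 (hinj hxy)).1) a b)
    refine card_le_card_of_injOn Prod.fst ?_ ?_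
    · rintro ⟨x, y⟩ hz
      simp only [mem_coe, mem_filter] at hz ⊢
      obtain ⟨⟨hz1, hz2⟩, rfl⟩ := hz
      exact ⟨mem_Icc.2 (hab _ hz1), hz2⟩
    · intro x hx y hy hxy
      simp only [coe_filter, Set.mem_ofPred_eq] at hx hy
      exact Prod.ext hxy (hx.2.trans hy.2.symm)
  -- Ranks are distinct across the whole plane, so the low-rank terms of all rows together cost at
  -- most one perimeter term.
  have h5 : ∑ j ∈ C.image Prod.snd, #{i ∈ Icc a b | (rank (i, j) : ℤ) < b - a} ≤
      #(C.image Prod.fst) := by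
    rw [← card_sigma]
    calc _ ≤ #(range (#(C.image Prod.fst))) := by
          refine card_le_card_of_injOn (fun p => rank (p.2, p.1)) ?_ ?_
          · rintro ⟨j, i⟩ hp
            simp only [mem_coe, mem_sigma, mem_filter, mem_range] at hp ⊢
            omega
          · rintro ⟨j, i⟩ _ ⟨j', i'⟩ _ hp
            have := hinj hp
            simp only [Prod.mk.injEq] at this
            obtain ⟨rfl, rfl⟩ := this
            rfl
      _ = _ := card_range _
  -- With `R` rows and `K` columns in `C`, averaging `h1` and `h2` gives `#C ≥ #A + 3R + 3K`, while
  -- at most `2R + K` points are colour changes.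
  rw [sum_add_distrib, sum_const, smul_eq_mul] at h4
  omega

end Isoperimetry

/-! ### Hall's condition with a surplus, and extension of finite matchings. -/

section Hall

open scoped Pointwise

theorem exists_interval_of_no_gap {B : Finset ℤ} (hB : B.Nonempty)
    (hgap : ∀ m, (∃ z ∈ B, z < m) → (∃ z ∈ B, m < z) → ∃ z ∈ B, |m - z| ≤ 3) :
    ∃ a b, (∀ z ∈ B, a + 3 ≤ z ∧ z ≤ b - 3) ∧ ∀ m, a ≤ m → m ≤ b → ∃ z ∈ B, |m - z| ≤ 3 := by
  refine ⟨B.min' hB - 3, B.max' hB + 3, fun z hz => ?_, fun m ha hb => ?_⟩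
  · have := B.min'_le z hz
    have := B.le_max' z hz
    omega
  · by_cases h1 : m ≤ B.min' hB
    · exact ⟨_, B.min'_mem hB, by rw [abs_le]; omega⟩
    by_cases h2 : B.max' hB ≤ m
    · exact ⟨_, B.max'_mem hB, by rw [abs_le]; omega⟩
    exact hgap m ⟨_, B.min'_mem hB, by omega⟩ ⟨_, B.max'_mem hB, by omega⟩

variable {X : Type} [AddAction (ℤ × ℤ) X]

open Classical in
/-- The points that can be reached from `x` by a displacement in the box and whose colour differs
from that of their successor. -/
noncomputable def escapeTargets (c : X → Bool) (x : X) : Finset X :=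
  {y ∈ displacementBox.image (fun s => s +ᵥ x) | c (((1, 0) : ℤ × ℤ) +ᵥ y) ≠ c y}

theorem mem_escapeTargets {c : X → Bool} {x y : X} :
    y ∈ escapeTargets c x ↔
      (∃ s ∈ displacementBox, s +ᵥ x = y) ∧ c (((1, 0) : ℤ × ℤ) +ᵥ y) ≠ c y := by
  simp only [escapeTargets, mem_filter, mem_image]

/-- The colouring of an action of `ℤ²` follows the nearest-smaller rule on each row, up to
alternation. -/
def RowsFollowNearestSmaller (rank : X → ℕ) (c : X → Bool) : Prop :=
  ∀ x, FollowsNearestSmaller (fun i => rank (((i, 0) : ℤ × ℤ) +ᵥ x))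
    (fun i => xor (c (((i, 0) : ℤ × ℤ) +ᵥ x)) i.bodd)

variable {rank : X → ℕ} {c : X → Bool}

/-- By freeness the orbit map identifies the orbit of `x` with `ℤ²`. Adding the parity of the first
coordinate to `c` turns defects into colour changes. -/
theorem card_add_perimeter_le_card_biUnion_escapeTargets [DecidableEq X]
    (hfree : ∀ (u : ℤ × ℤ) (x : X), u +ᵥ x = x → u = 0) (hinj : Function.Injective rank)
    (hrows : RowsFollowNearestSmaller rank c) (x : X) (A : Finset (ℤ × ℤ)) {a b : ℤ}
    (hab : ∀ z ∈ A + displacementBox, a ≤ z.1 ∧ z.1 ≤ b)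
    (hcard : b - a + 1 ≤ #((A + displacementBox).image Prod.fst)) :
    #A + #((A + displacementBox).image Prod.snd) + #((A + displacementBox).image Prod.fst) ≤
      #((A.image (fun u => u +ᵥ x)).biUnion (escapeTargets c)) := by
  have he : Function.Injective (fun u : ℤ × ℤ => u +ᵥ x) := by
    intro u v huv
    have huv' : u +ᵥ x = v +ᵥ x := huv
    have : (-v + u) +ᵥ x = x := by rw [add_vadd, huv', neg_vadd_vadd]
    exact (neg_add_eq_zero.1 (hfree _ _ this)).symm
  have key := card_add_perimeter_le (rank := fun z => rank (z +ᵥ x))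
    (χ := fun z => xor (c (z +ᵥ x)) z.1.bodd) (fun u v huv => he (hinj huv)) (fun j => by
      have := hrows (((0, j) : ℤ × ℤ) +ᵥ x)
      simpa only [← add_vadd, Prod.mk_add_mk, add_zero, zero_add] using this) A hab hcard
  refine key.trans ?_
  rw [← card_image_of_injective _ he]
  refine card_le_card fun y hy => ?_
  obtain ⟨z, hz, rfl⟩ := mem_image.1 hy
  obtain ⟨hz, hc⟩ := mem_filter.1 hz
  obtain ⟨u, hu, s, hs, rfl⟩ := mem_add.1 hz
  refine mem_biUnion.2 ⟨u +ᵥ x, mem_image_of_mem _ hu, mem_escapeTargets.2 ⟨⟨s, hs, ?_⟩, ?_⟩⟩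
  · rw [← add_vadd, add_comm]
  · have h1 : ((1, 0) : ℤ × ℤ) + (u + s) = ((u + s).1 + 1, (u + s).2) := by
      ext <;> simp [add_comm]
    rw [← add_vadd, h1]
    dsimp only at hc
    rw [Int.bodd_add] at hc
    intro heq
    rw [heq] at hc
    revert hc
    cases c ((u + s) +ᵥ x) <;> cases (u + s).1.bodd <;> simp

/-- Hall's condition for the points of large rank, given a matching of a neighbourhood of the
points of small rank. -/
theorem card_le_card_biUnion_escapeTargets_sdiff [DecidableEq X]
    (hfree : ∀ (u : ℤ × ℤ) (x : X), u +ᵥ x = x → u = 0) (hinj : Function.Injective rank)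
    (hrows : RowsFollowNearestSmaller rank c) {k L : ℕ} {τ : X → X}
    (hball : ∀ x, rank x < k → ∀ u : ℤ × ℤ, |u.1| ≤ k + 6 → |u.2| ≤ k + 6 → rank (u +ᵥ x) < L)
    (hτ : ∀ x, rank x < L → τ x ∈ escapeTargets c x) (hτi : Set.InjOn τ {x | rank x < L})
    {U : Finset X} (hU : ∀ y, y ∈ U ↔ ∃ x, rank x < k ∧ τ x = y) (hUk : #U ≤ k)
    (A : Finset X) (hA : ∀ x ∈ A, k ≤ rank x) :
    #A ≤ #(A.biUnion (fun x => escapeTargets c x \ U)) := by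
  induction hm : #A using Nat.strong_induction_on generalizing A with
  | _ m ih =>
    subst hm
    have hsplit : ∀ p : X → Prop, (∃ x ∈ A, p x) → (∃ x ∈ A, ¬ p x) →
        (∀ x ∈ A, ∀ y ∈ A, p x → ¬ p y → Disjoint (escapeTargets c x) (escapeTargets c y)) →
        #A ≤ #(A.biUnion (fun x => escapeTargets c x \ U)) := by
      classical
      intro p hp hnp hdisj
      have hsum : #{x ∈ A | p x} + #{x ∈ A | ¬ p x} = #A := card_filter_add_card_filter_not _
      have h1 : 0 < #{x ∈ A | p x} := card_pos.2 (by simpa [Finset.Nonempty] using hp)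
      have h2 : 0 < #{x ∈ A | ¬ p x} := card_pos.2 (by simpa [Finset.Nonempty] using hnp)
      have e1 := ih _ (by omega) {x ∈ A | p x} (fun x hx => hA x (mem_filter.1 hx).1) rfl
      have e2 := ih _ (by omega) {x ∈ A | ¬ p x} (fun x hx => hA x (mem_filter.1 hx).1) rfl
      have hd : Disjoint ({x ∈ A | p x}.biUnion (fun x => escapeTargets c x \ U))
          ({x ∈ A | ¬ p x}.biUnion (fun x => escapeTargets c x \ U)) := by
        rw [disjoint_biUnion_left]
        intro x hx
        rw [disjoint_biUnion_right]
        intro y hy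
        rw [mem_filter] at hx hy
        exact (hdisj x hx.1 y hy.1 hx.2 hy.2).mono sdiff_subset sdiff_subset
      calc #A ≤ _ := by rw [← hsum]; exact add_le_add e1 e2
        _ = _ := (card_union_of_disjoint hd).symm
        _ ≤ _ := card_le_card (union_subset
          (biUnion_subset_biUnion_of_subset_left _ (filter_subset _ _))
          (biUnion_subset_biUnion_of_subset_left _ (filter_subset _ _)))
    rcases A.eq_empty_or_nonempty with rfl | ⟨x₀, hx₀⟩
    · simp
    have hmeet : ∀ x y, ¬ Disjoint (escapeTargets c x) (escapeTargets c y) →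
        ∃ s ∈ displacementBox, ∃ t ∈ displacementBox, y = (-t + s) +ᵥ x := by
      intro x y hxy
      rw [not_disjoint_iff] at hxy
      obtain ⟨z, hz1, hz2⟩ := hxy
      obtain ⟨⟨s, hs, hsz⟩, -⟩ := mem_escapeTargets.1 hz1
      obtain ⟨⟨t, ht, htz⟩, -⟩ := mem_escapeTargets.1 hz2
      exact ⟨s, hs, t, ht, by rw [add_vadd, hsz, ← htz, neg_vadd_vadd]⟩
    have he : Function.Injective (fun u : ℤ × ℤ => u +ᵥ x₀) := by
      intro u v huv
      have huv' : u +ᵥ x₀ = v +ᵥ x₀ := huv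
      have : (-v + u) +ᵥ x₀ = x₀ := by rw [add_vadd, huv', neg_vadd_vadd]
      exact (neg_add_eq_zero.1 (hfree _ _ this)).symm
    -- A set that meets several orbits splits.
    by_cases horb : ∃ x ∈ A, ¬ ∃ u : ℤ × ℤ, u +ᵥ x₀ = x
    · refine hsplit (fun x => ∃ u : ℤ × ℤ, u +ᵥ x₀ = x) ⟨x₀, hx₀, 0, zero_vadd _ _⟩ horb ?_
      rintro x - y - ⟨u, rfl⟩ hy
      by_contra hxy
      obtain ⟨s, -, t, -, rfl⟩ := hmeet _ _ hxy
      exact hy ⟨(-t + s) + u, add_vadd _ _ _⟩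
    push Not at horb
    set B : Finset (ℤ × ℤ) := A.preimage (fun u => u +ᵥ x₀) he.injOn with hB
    have hmemB : ∀ u, u ∈ B ↔ u +ᵥ x₀ ∈ A := fun u => by simp [hB]
    have hBA : B.image (fun u => u +ᵥ x₀) = A := by
      ext x
      rw [mem_image]
      constructor
      · rintro ⟨u, hu, rfl⟩; exact (hmemB u).1 hu
      · intro hx
        obtain ⟨u, rfl⟩ := horb x hx
        exact ⟨u, (hmemB u).2 hx, rfl⟩
    have hBcard : #A = #B := by rw [← hBA, card_image_of_injective _ he]
    have hBne : B.Nonempty := ⟨0, (hmemB 0).2 (by simpa using hx₀)⟩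
    -- So does a set with a gap in a coordinate direction.
    have hgap : ∀ f : ℤ × ℤ →+ ℤ, (∀ s ∈ displacementBox, -3 ≤ f s ∧ f s ≤ 3) →
        (∃ m, (∃ z ∈ B.image f, z < m) ∧ (∃ z ∈ B.image f, m < z) ∧
          ∀ z ∈ B.image f, 3 < |m - z|) →
        #A ≤ #(A.biUnion (fun x => escapeTargets c x \ U)) := by
      rintro f hf ⟨m, ⟨z₁, hz₁, hzm₁⟩, ⟨z₂, hz₂, hzm₂⟩, hfar⟩
      obtain ⟨u₁, hu₁, rfl⟩ := mem_image.1 hz₁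
      obtain ⟨u₂, hu₂, rfl⟩ := mem_image.1 hz₂
      refine hsplit (fun x => ∃ u : ℤ × ℤ, u +ᵥ x₀ = x ∧ f u < m)
        ⟨_, (hmemB _).1 hu₁, u₁, rfl, hzm₁⟩ ⟨_, (hmemB _).1 hu₂, ?_⟩ ?_
      · rintro ⟨u, hu, hum⟩
        rw [he hu] at hum
        omega
      · rintro x hx y hy ⟨u, rfl, hum⟩ hny
        by_contra hxy
        obtain ⟨s, hs, t, ht, rfl⟩ := hmeet _ _ hxy
        rw [← add_vadd] at hy hny
        have h1 := hfar (f u) (mem_image_of_mem _ ((hmemB _).2 hx))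
        have h2 := hfar _ (mem_image_of_mem f ((hmemB _).2 hy))
        have h3 : ¬ f (-t + s + u) < m := fun hlt => hny ⟨_, rfl, hlt⟩
        rw [map_add, map_add, map_neg] at h2 h3
        have := hf s hs
        have := hf t ht
        rw [abs_of_pos (by omega)] at h1
        rcases abs_cases (m - (-f t + f s + f u)) with h | h <;> omega
    by_cases hg1 : ∃ m, (∃ z ∈ B.image Prod.fst, z < m) ∧ (∃ z ∈ B.image Prod.fst, m < z) ∧
          ∀ z ∈ B.image Prod.fst, 3 < |m - z|
    · exact hgap (AddMonoidHom.fst ℤ ℤ) (fun s hs => (mem_displacementBox.1 hs).1) hg1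
    by_cases hg2 : ∃ m, (∃ z ∈ B.image Prod.snd, z < m) ∧ (∃ z ∈ B.image Prod.snd, m < z) ∧
          ∀ z ∈ B.image Prod.snd, 3 < |m - z|
    · exact hgap (AddMonoidHom.snd ℤ ℤ) (fun s hs => (mem_displacementBox.1 hs).2) hg2
    push Not at hg1 hg2
    obtain ⟨a, b, hab, hcov⟩ := exists_interval_of_no_gap (hBne.image Prod.fst) hg1
    obtain ⟨a', b', hab', hcov'⟩ := exists_interval_of_no_gap (hBne.image Prod.snd) hg2
    have hc1 : b - a + 1 ≤ #((B + displacementBox).image Prod.fst) := by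
      have hsub : Icc a b ⊆ (B + displacementBox).image Prod.fst := by
        intro m hm
        rw [mem_Icc] at hm
        obtain ⟨z, hz, hzm⟩ := hcov m hm.1 hm.2
        obtain ⟨u, hu, rfl⟩ := mem_image.1 hz
        refine mem_image.2 ⟨u + (m - u.1, 0), add_mem_add hu ?_, by simp⟩
        rw [mem_displacementBox]
        exact ⟨abs_le.1 hzm, by norm_num⟩
      have := card_le_card hsub
      rw [Int.card_Icc] at this
      omega
    have hc2 : b' - a' + 1 ≤ #((B + displacementBox).image Prod.snd) := by
      have hsub : Icc a' b' ⊆ (B + displacementBox).image Prod.snd := by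
        intro m hm
        rw [mem_Icc] at hm
        obtain ⟨z, hz, hzm⟩ := hcov' m hm.1 hm.2
        obtain ⟨u, hu, rfl⟩ := mem_image.1 hz
        refine mem_image.2 ⟨u + (0, m - u.2), add_mem_add hu ?_, by simp⟩
        rw [mem_displacementBox]
        exact ⟨by norm_num, abs_le.1 hzm⟩
      have := card_le_card hsub
      rw [Int.card_Icc] at this
      omega
    have hper := card_add_perimeter_le_card_biUnion_escapeTargets hfree hinj hrows x₀ B
      (a := a) (b := b) (by
        intro z hz
        obtain ⟨u, hu, s, hs, rfl⟩ := mem_add.1 hz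
        have h1 := hab u.1 (mem_image_of_mem _ hu)
        have h2 := mem_displacementBox.1 hs
        rw [Prod.fst_add]
        omega) hc1
    rw [hBA, ← hBcard] at hper
    have hbi : A.biUnion (fun x => escapeTargets c x \ U) = A.biUnion (escapeTargets c) \ U := by
      ext y
      simp only [mem_biUnion, Finset.mem_sdiff]
      exact ⟨fun ⟨x, hx, hy, hn⟩ => ⟨⟨x, hx, hy⟩, hn⟩, fun ⟨⟨x, hx, hy⟩, hn⟩ => ⟨x, hx, hy, hn⟩⟩
    by_cases htouch : Disjoint (A.biUnion (escapeTargets c)) U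
    · rw [hbi, sdiff_eq_self_of_disjoint htouch]
      omega
    by_contra hlt
    rw [hbi] at hlt
    -- Removing `U` costs at most `k` targets, so a violation of Hall's condition forces the
    -- perimeter in `hper` below `k`.
    have hsd := le_card_sdiff U (A.biUnion (escapeTargets c))
    rw [not_disjoint_iff] at htouch
    obtain ⟨w, hw, hwU⟩ := htouch
    obtain ⟨a₀, ha₀, hwa₀⟩ := mem_biUnion.1 hw
    obtain ⟨y, hy, rfl⟩ := (hU w).1 hwU
    have hyL : rank y < L := by
      simpa using hball y hy 0 (by simp; omega) (by simp; omega)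
    obtain ⟨s, hs, t, ht, hst⟩ := hmeet y a₀ (not_disjoint_iff.2 ⟨τ y, hτ y hyL, hwa₀⟩)
    -- `A` shares a target with `y`, at a cost of at most 6 per coordinate, and spans less than `k`
    -- in each direction. Hence `hball` applies to all of `A`.
    have hAL : ∀ x ∈ A, rank x < L := by
      intro x hx
      obtain ⟨u, hu, rfl⟩ := mem_image.1 (hBA ▸ hx)
      obtain ⟨u₀, hu₀, rfl⟩ := mem_image.1 (hBA ▸ ha₀)
      have h1 : u +ᵥ x₀ = (u - u₀ + (-t + s)) +ᵥ y := by
        rw [add_vadd, ← hst, ← add_vadd, sub_add_cancel]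
      rw [h1]
      have := hab u.1 (mem_image_of_mem _ hu)
      have := hab u₀.1 (mem_image_of_mem _ hu₀)
      have := hab' u.2 (mem_image_of_mem _ hu)
      have := hab' u₀.2 (mem_image_of_mem _ hu₀)
      have := mem_displacementBox.1 hs
      have := mem_displacementBox.1 ht
      apply hball y hy <;>
      · simp only [Prod.fst_add, Prod.fst_sub, Prod.fst_neg, Prod.snd_add, Prod.snd_sub,
          Prod.snd_neg, abs_le]
        omega
    -- Now `τ` itself matches `A`, and by injectivity it avoids `U`, whose elements are values of
    -- `τ` at points of rank below `k`.
    apply hlt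
    rw [← card_image_of_injOn (hτi.mono (fun x hx => hAL x hx))]
    refine card_le_card fun w hw => ?_
    obtain ⟨x, hx, rfl⟩ := mem_image.1 hw
    refine Finset.mem_sdiff.2 ⟨mem_biUnion.2 ⟨x, hx, hτ x (hAL x hx)⟩, fun hxU => ?_⟩
    obtain ⟨y', hy', hxy⟩ := (hU _).1 hxU
    have hy'L : rank y' < L := by
      simpa using hball y' hy' 0 (by simp; omega) (by simp; omega)
    have := hτi hy'L (hAL x hx) hxy
    subst this
    have := hA _ hx
    omega

/-- A matching of a neighbourhood of the points of small rank has the same values there as some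
matching of the whole space. -/
theorem exists_matching_extending
    (hfree : ∀ (u : ℤ × ℤ) (x : X), u +ᵥ x = x → u = 0) (hinj : Function.Injective rank)
    (hrows : RowsFollowNearestSmaller rank c) {k L : ℕ} {τ : X → X}
    (hball : ∀ x, rank x < k → ∀ u : ℤ × ℤ, |u.1| ≤ k + 6 → |u.2| ≤ k + 6 → rank (u +ᵥ x) < L)
    (hτ : ∀ x, rank x < L → τ x ∈ escapeTargets c x) (hτi : Set.InjOn τ {x | rank x < L}) :
    ∃ N : X → X, Function.Injective N ∧ (∀ x, N x ∈ escapeTargets c x) ∧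
      ∀ x, rank x < k → N x = τ x := by
  classical
  have hfin : {x | rank x < k}.Finite :=
    (Set.finite_Iio k).preimage hinj.injOn
  set U := hfin.toFinset.image τ
  have hU : ∀ y, y ∈ U ↔ ∃ x, rank x < k ∧ τ x = y := fun y => by simp [U]
  have hUk : #U ≤ k := by
    refine card_image_le.trans ?_
    calc _ ≤ #(range k) := card_le_card_of_injOn rank (fun x hx => by simpa using hx) hinj.injOn
      _ = k := card_range k
  obtain ⟨f, hf, hft⟩ := (all_card_le_biUnion_card_iff_exists_injective
    (fun x : {x : X // k ≤ rank x} => escapeTargets c (x : X) \ U)).1 (fun A => by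
      have := card_le_card_biUnion_escapeTargets_sdiff hfree hinj hrows hball hτ hτi hU hUk
        (A.image Subtype.val) (fun x hx => by
          obtain ⟨z, -, rfl⟩ := mem_image.1 hx
          exact z.2)
      rwa [card_image_of_injective _ Subtype.val_injective, image_biUnion] at this)
  have hkL : ∀ x, rank x < k → rank x < L := fun x hx => by
    simpa using hball x hx 0 (by simp; omega) (by simp; omega)
  refine ⟨fun x => if h : k ≤ rank x then f ⟨x, h⟩ else τ x, ?_, ?_, ?_⟩
  · intro x y hxy
    dsimp only at hxy
    split_ifs at hxy with hx hy hy
    · simpa using hf hxy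
    · exact absurd ((hU _).2 ⟨y, by omega, rfl⟩) (hxy ▸ (Finset.mem_sdiff.1 (hft ⟨x, hx⟩)).2)
    · exact absurd ((hU _).2 ⟨x, by omega, rfl⟩) (hxy ▸ (Finset.mem_sdiff.1 (hft ⟨y, hy⟩)).2)
    · exact hτi (hkL x (by omega)) (hkL y (by omega)) hxy
  · intro x
    dsimp only
    split_ifs with hx
    · exact (Finset.mem_sdiff.1 (hft ⟨x, hx⟩)).1
    · exact hτ x (hkL x (by omega))
  · intro x hx
    dsimp only
    rw [dif_neg (by omega)]

end Hall

/-! ### From reliable finite matchings to a computable one. -/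

section ComputableMatching

theorem Computable.nat_iterate {α σ : Type*} [Primcodable α] [Primcodable σ] {f : σ → σ}
    {m : α → ℕ} {g : α → σ} (hf : Computable f) (hm : Computable m) (hg : Computable g) :
    Computable (fun a => f^[m a] (g a)) := by
  refine (Computable.nat_rec (h := fun _ p => f p.2) hm hg
    (hf.comp (Computable.snd.comp Computable.snd))).of_eq fun a => ?_
  generalize m a = k
  induction k with
  | zero => rfl
  | succ k ih => rw [Function.iterate_succ_apply', ← ih]

theorem Computable.list_map_range {σ : Type*} [Primcodable σ] {f : ℕ → σ} (hf : Computable f) :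
    Computable (fun n => (List.range n).map f) := by
  refine (Computable.nat_rec (f := id) (g := fun _ => ([] : List σ))
    (h := fun _ p => p.2 ++ [f p.1]) Computable.id (Computable.const _)
    (Computable.list_concat.comp (Computable.snd.comp Computable.snd)
      (hf.comp (Computable.fst.comp Computable.snd)))).of_eq fun n => ?_
  induction n with
  | zero => rfl
  | succ n ih =>
    rw [List.range_succ, List.map_append, ← ih]
    rfl

theorem primrecRel_forall_lt {α : Type*} [Primcodable α] {R : ℕ → α → Prop} (hR : PrimrecRel R) :
    PrimrecRel fun (n : ℕ) (a : α) => ∀ x < n, R x a :=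
  (hR.forall_mem_list.comp (Primrec.list_range.comp Primrec.fst) Primrec.snd).of_eq (by simp)

/-- The list `τ` codes a matching into the lists `T` on `[0, n)` which extends `σ`. -/
def ExtendsMatching (T : List (List ℕ)) (n : ℕ) (σ τ : List ℕ) : Prop :=
  (∀ x < σ.length, τ.getD x 0 = σ.getD x 0) ∧
  (∀ x < n, ∃ a ∈ T.getD x [], a = τ.getD x 0) ∧
  ∀ x < n, ∀ y < n, τ.getD x 0 = τ.getD y 0 → x = y

theorem primrecPred_extendsMatching :
    PrimrecPred (fun p : (List (List ℕ) × ℕ) × (List ℕ × List ℕ) =>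
      ExtendsMatching p.1.1 p.1.2 p.2.1 p.2.2) := by
  have hget : ∀ {α : Type} [Primcodable α] {f : α → List ℕ} {g : α → ℕ}, Primrec f → Primrec g →
      Primrec (fun a => (f a).getD (g a) 0) := fun hf hg => (Primrec.list_getD 0).comp hf hg
  have h1 : PrimrecRel (fun (x : ℕ) (p : List ℕ × List ℕ) => p.2.getD x 0 = p.1.getD x 0) :=
    Primrec.eq.comp
      (hget (Primrec.snd.comp Primrec.snd) Primrec.fst)
      (hget (Primrec.fst.comp Primrec.snd) Primrec.fst)
  have h2 : PrimrecRel (fun (x : ℕ) (p : List (List ℕ) × List ℕ) =>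
      ∃ a ∈ p.1.getD x [], a = p.2.getD x 0) :=
    (PrimrecRel.exists_mem_list (R := fun a b : ℕ => a = b) Primrec.eq).comp
      ((Primrec.list_getD []).comp (Primrec.fst.comp Primrec.snd) Primrec.fst)
      (hget (Primrec.snd.comp Primrec.snd) Primrec.fst)
  have h3 : PrimrecRel (fun (y : ℕ) (p : ℕ × List ℕ) =>
      p.2.getD p.1 0 = p.2.getD y 0 → p.1 = y) := by
    refine PrimrecPred.of_eq (p := fun q : ℕ × (ℕ × List ℕ) =>
      ¬ q.2.2.getD q.2.1 0 = q.2.2.getD q.1 0 ∨ q.2.1 = q.1) ?_ (fun q => by tauto)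
    refine PrimrecPred.or (PrimrecPred.not ?_) ?_
    · exact Primrec.eq.comp
        (hget (Primrec.snd.comp Primrec.snd) (Primrec.fst.comp Primrec.snd))
        (hget (Primrec.snd.comp Primrec.snd) Primrec.fst)
    · exact Primrec.eq.comp (Primrec.fst.comp Primrec.snd) Primrec.fst
  have h3' := primrecRel_forall_lt h3
  have h4 : PrimrecRel (fun (x : ℕ) (p : ℕ × List ℕ) =>
      ∀ y < p.1, p.2.getD x 0 = p.2.getD y 0 → x = y) :=
    h3'.comp (f := fun q : ℕ × (ℕ × List ℕ) => q.2.1)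
        (g := fun q => (q.1, q.2.2)) (Primrec.fst.comp Primrec.snd)
        (Primrec.pair Primrec.fst (Primrec.snd.comp Primrec.snd))
  refine PrimrecPred.and ?_ (PrimrecPred.and ?_ ?_)
  · exact (primrecRel_forall_lt h1).comp
      (Primrec.list_length.comp (Primrec.fst.comp Primrec.snd)) Primrec.snd
  · exact (primrecRel_forall_lt h2).comp (Primrec.snd.comp Primrec.fst)
      (Primrec.pair (Primrec.fst.comp Primrec.fst) (Primrec.snd.comp Primrec.snd))
  · exact (primrecRel_forall_lt h4).comp (Primrec.snd.comp Primrec.fst)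
      (Primrec.pair (Primrec.snd.comp Primrec.fst) (Primrec.snd.comp Primrec.snd))

theorem getD_map_range {α : Type*} (f : ℕ → α) (d : α) {n x : ℕ} (hx : x < n) :
    ((List.range n).map f).getD x d = f x := by
  simp [List.getD_eq_getElem?_getD, hx]

/-- If matchings of sufficiently long initial segments agree on shorter ones with matchings of the
whole, effectively, then there is a computable matching. -/
theorem exists_computable_matching {t : ℕ → List ℕ} (ht : Computable t) {L : ℕ → ℕ}
    (hL : Computable L)
    (h₀ : ∃ N : ℕ → ℕ, Function.Injective N ∧ ∀ x, N x ∈ t x)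
    (hext : ∀ (k : ℕ) (τ : ℕ → ℕ), (∀ x < L k, τ x ∈ t x) → Set.InjOn τ (Set.Iio (L k)) →
      ∃ N : ℕ → ℕ, Function.Injective N ∧ (∀ x, N x ∈ t x) ∧ ∀ x < k, N x = τ x) :
    ∃ N : ℕ → ℕ, Computable N ∧ Function.Injective N ∧ ∀ x, N x ∈ t x := by
  classical
  let n : List ℕ → ℕ := fun σ => L (σ.length + 1)
  let P : List ℕ → ℕ → Prop := fun σ m =>
    ExtendsMatching ((List.range (n σ)).map t) (n σ) σ (Denumerable.ofNat (List ℕ) m)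
  let next : List ℕ → ℕ → List ℕ := fun σ m =>
    σ ++ [(Denumerable.ofNat (List ℕ) m).getD σ.length 0]
  let step : List ℕ →. List ℕ := fun σ =>
    (Nat.rfind (fun m => Part.some (decide (P σ m)))).map (next σ)
  have hn : Computable n := hL.comp (Computable.succ.comp Computable.list_length)
  have hstep : Partrec step := by
    refine Partrec.map (Partrec.rfind (Computable.partrec ?_)) ?_
    · have hP : Computable (fun p : (List (List ℕ) × ℕ) × (List ℕ × List ℕ) =>
          decide (ExtendsMatching p.1.1 p.1.2 p.2.1 p.2.2)) :=
        (primrecPred_iff_primrec_decide.1 primrecPred_extendsMatching).to_comp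
      exact hP.comp (Computable.pair
        (Computable.pair ((Computable.list_map_range ht).comp (hn.comp Computable.fst))
          (hn.comp Computable.fst))
        (Computable.pair Computable.fst ((Computable.ofNat _).comp Computable.snd)))
    · exact Computable.list_concat.comp Computable.fst
        ((Primrec.list_getD 0).to_comp.comp ((Computable.ofNat _).comp Computable.snd)
          (Computable.list_length.comp Computable.fst))
  -- The invariant of the search. It is not decided by the algorithm: `hext` guarantees that any
  -- finite matching found preserves it.
  let Good : List ℕ → Prop := fun σ => ∃ N : ℕ → ℕ, Function.Injective N ∧ (∀ x, N x ∈ t x) ∧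
    ∀ x < σ.length, N x = σ.getD x 0
  have hgood : ∀ σ, Good σ → ∃ a, σ ++ [a] ∈ step σ ∧ Good (σ ++ [a]) := by
    rintro σ ⟨N, hNi, hNt, hNσ⟩
    -- The search halts because a restriction of the global matching qualifies. The length `σ.length
    -- + n σ` keeps both ranges free of the default value of `getD`.
    have hex : P σ (Encodable.encode ((List.range (σ.length + n σ)).map N)) := by
      have hget : ∀ x < σ.length + n σ, ((List.range (σ.length + n σ)).map N).getD x 0 = N x :=
        fun x hx => getD_map_range N 0 hx
      simp only [P, Denumerable.ofNat_encode]
      refine ⟨fun x hx => ?_, fun x hx => ?_, fun x hx y hy hxy => ?_⟩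
      · rw [hget x (by omega), hNσ x hx]
      · rw [getD_map_range t [] hx, hget x (by omega)]
        exact ⟨_, hNt x, rfl⟩
      · rw [hget x (by omega), hget y (by omega)] at hxy
        exact hNi hxy
    obtain ⟨m, hm, -⟩ := Nat.rfind_min' (p := fun m => decide (P σ m)) (by simpa using hex)
    have hPm : P σ m := by simpa using Nat.rfind_spec hm
    refine ⟨_, Part.mem_map (next σ) hm, ?_⟩
    obtain ⟨h1, h2, h3⟩ := hPm
    obtain ⟨N', hN'i, hN't, hN'τ⟩ := hext (σ.length + 1)
      (fun x => (Denumerable.ofNat (List ℕ) m).getD x 0)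
      (fun x hx => by
        obtain ⟨a, ha, hax⟩ := h2 x hx
        rw [getD_map_range t [] hx] at ha
        exact hax ▸ ha)
      (fun x hx y hy hxy => h3 x hx y hy hxy)
    refine ⟨N', hN'i, hN't, fun x hx => ?_⟩
    rw [List.length_append, List.length_singleton] at hx
    rw [hN'τ x hx]
    rcases Nat.lt_succ_iff_lt_or_eq.1 hx with hx | rfl
    · rw [h1 x hx, List.getD_append _ _ _ _ hx]
    · rw [List.getD_append_right _ _ _ _ le_rfl]
      simp
  let seq : ℕ →. List ℕ := fun k => Nat.rec (Part.some []) (fun _ ih => ih.bind step) k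
  have hseq : Partrec seq :=
    Partrec.nat_rec (f := id) (g := fun _ => Part.some ([] : List ℕ))
      (h := fun _ p => step p.2) Computable.id (Computable.const []).partrec
      (hstep.comp (Computable.snd.comp Computable.snd))
  have hgood₀ : Good [] := by
    obtain ⟨N, hNi, hNt⟩ := h₀
    exact ⟨N, hNi, hNt, fun x hx => absurd hx (by simp)⟩
  choose! a ha using hgood
  let s : ℕ → List ℕ := fun k => Nat.rec [] (fun _ σ => σ ++ [a σ]) k
  have hs : ∀ k, s k ∈ seq k ∧ Good (s k) ∧ (s k).length = k := by
    intro k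
    induction k with
    | zero => exact ⟨Part.mem_some _, hgood₀, rfl⟩
    | succ k ih =>
      refine ⟨Part.mem_bind_iff.2 ⟨s k, ih.1, (ha _ ih.2.1).1⟩, (ha _ ih.2.1).2, ?_⟩
      change (s k ++ [a (s k)]).length = k + 1
      simp [ih.2.2]
  have hsc : Computable s := hseq.of_eq_tot fun k => (hs k).1
  have hstable : ∀ k x, x < k → (s k).getD x 0 = (s (x + 1)).getD x 0 := by
    intro k x hx
    induction k with
    | zero => omega
    | succ k ih =>
      rcases Nat.lt_succ_iff_lt_or_eq.1 hx with hx | rfl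
      · rw [← ih hx]
        exact List.getD_append _ _ _ _ (by rw [(hs k).2.2]; exact hx)
      · rfl
  refine ⟨fun k => (s (k + 1)).getD k 0, ?_, ?_, ?_⟩
  · exact (Primrec.list_getD 0).to_comp.comp (hsc.comp Computable.succ) Computable.id
  · intro x y hxy
    obtain ⟨N, hNi, -, hN⟩ := (hs (x + y + 1)).2.1
    rw [(hs (x + y + 1)).2.2] at hN
    dsimp only at hxy
    rw [← hstable (x + y + 1) x (by omega), ← hstable (x + y + 1) y (by omega),
      ← hN x (by omega), ← hN y (by omega)] at hxy
    exact hNi hxy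
  · intro x
    obtain ⟨N, -, hNt, hN⟩ := (hs (x + 1)).2.1
    rw [(hs (x + 1)).2.2] at hN
    dsimp only
    rw [← hN x (by omega)]
    exact hNt x

end ComputableMatching

/-! ### The computable nearest-smaller colouring. -/

section NearestColor

variable (F F' : ℕ → ℕ)

/-- The first `r ∈ [1, m]` such that `F^[r] x` or `F'^[r] x` is an index into the list `prev` of
colours determines a colour, by alternation. -/
def scanColor (prev : List Bool) (x m : ℕ) : Option Bool :=
  Nat.rec none (fun r acc => acc <|>
    ((prev[F^[r + 1] x]?).map (xor (r + 1).bodd) <|>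
      (prev[F'^[r + 1] x]?).map (xor (r + 1).bodd))) m

/-- The list of the colours of the numbers below `n`. -/
def colorList (n : ℕ) : List Bool :=
  Nat.rec [] (fun x l => l ++ [(scanColor F F' l x (x + 1)).getD false]) n

/-- The colour of `x` is obtained by alternation from the nearest smaller number along the
iterates of `F` and `F'` within distance `x + 1`, if there is one. -/
def nearestColor (x : ℕ) : Bool :=
  (scanColor F F' (colorList F F' x) x (x + 1)).getD false

variable {F F'}

theorem colorList_eq_map (n : ℕ) :
    colorList F F' n = (List.range n).map (nearestColor F F') := by
  induction n with
  | zero => rfl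
  | succ n ih =>
    rw [List.range_succ, List.map_append, ← ih]
    rfl

theorem computable_nearestColor (hF : Computable F) (hF' : Computable F') :
    Computable (nearestColor F F') := by
  have hscan : Computable (fun p : List Bool × ℕ => scanColor F F' p.1 p.2 (p.2 + 1)) := by
    have hlook : ∀ {G : ℕ → ℕ}, Computable G →
        Computable (fun q : (List Bool × ℕ) × (ℕ × Option Bool) =>
          (q.1.1[G^[q.2.1 + 1] q.1.2]?).map (xor (q.2.1 + 1).bodd)) := by
      intro G hG
      have hr : Computable (fun q : (List Bool × ℕ) × (ℕ × Option Bool) => q.2.1 + 1) :=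
        Computable.succ.comp (Computable.fst.comp Computable.snd)
      refine Computable.option_map (Computable.list_getElem?.comp
        (Computable.fst.comp Computable.fst)
        (Computable.nat_iterate hG hr (Computable.snd.comp Computable.fst))) ?_
      exact (Primrec.dom_bool₂ xor).to_comp.comp
        (Computable.nat_bodd.comp (hr.comp Computable.fst)) Computable.snd
    refine Computable.nat_rec (f := fun p : List Bool × ℕ => p.2 + 1)
      (g := fun _ => (none : Option Bool))
      (h := fun p q => q.2 <|> ((p.1[F^[q.1 + 1] p.2]?).map (xor (q.1 + 1).bodd) <|>
        (p.1[F'^[q.1 + 1] p.2]?).map (xor (q.1 + 1).bodd)))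
      (Computable.succ.comp Computable.snd) (Computable.const _) ?_
    have hor : Computable₂ ((· <|> ·) : Option Bool → Option Bool → Option Bool) :=
      Primrec.option_orElse.to_comp
    exact hor.comp (Computable.snd.comp Computable.snd) (hor.comp (hlook hF) (hlook hF'))
  have hlist : Computable (colorList F F') := by
    refine Computable.nat_rec (f := id) (g := fun _ => ([] : List Bool))
      (h := fun _ p => p.2 ++ [(scanColor F F' p.2 p.1 (p.1 + 1)).getD false])
      Computable.id (Computable.const _) ?_
    have h := hscan.comp (g := fun p : ℕ × (ℕ × List Bool) => (p.2.2, p.2.1))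
      (Computable.pair (Computable.snd.comp Computable.snd) (Computable.fst.comp Computable.snd))
    exact Computable.list_concat.comp (Computable.snd.comp Computable.snd)
      (Computable.option_getD h (Computable.const false))
  have h := hscan.comp (g := fun x : ℕ => (colorList F F' x, x))
    (Computable.pair hlist Computable.id)
  exact Computable.option_getD h (Computable.const false)

/-- A lookup in the colour list of length `x` succeeds exactly below `x`, and earlier hits take
precedence, so the scan stops at the smallest distance. -/
theorem scanColor_spec (x m : ℕ) :
    (scanColor F F' (colorList F F' x) x m = none ∧
      ∀ r, 1 ≤ r → r ≤ m → x ≤ F^[r] x ∧ x ≤ F'^[r] x) ∨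
    ∃ r, 1 ≤ r ∧ r ≤ m ∧ (∀ r', 1 ≤ r' → r' < r → x ≤ F^[r'] x ∧ x ≤ F'^[r'] x) ∧
      ∃ y < x, (y = F^[r] x ∨ y = F'^[r] x) ∧
        scanColor F F' (colorList F F' x) x m = some (xor r.bodd (nearestColor F F' y)) := by
  induction m with
  | zero => exact Or.inl ⟨rfl, fun r h1 h2 => by omega⟩
  | succ m ih =>
    have hsucc : scanColor F F' (colorList F F' x) x (m + 1) =
        (scanColor F F' (colorList F F' x) x m <|>
          (((colorList F F' x)[F^[m + 1] x]?).map (xor (m + 1).bodd) <|>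
            ((colorList F F' x)[F'^[m + 1] x]?).map (xor (m + 1).bodd))) := rfl
    have hlt : ∀ {y}, y < x → (colorList F F' x)[y]? = some (nearestColor F F' y) := by
      intro y hy
      simp [colorList_eq_map, hy]
    have hge : ∀ {y}, ¬ y < x → (colorList F F' x)[y]? = none := by
      intro y hy
      simp [colorList_eq_map, hy]
    rcases ih with ⟨hn, hall⟩ | ⟨r, hr1, hrm, hmin, y, hy, hyr, hs⟩
    · rw [hsucc, hn]
      by_cases h1 : F^[m + 1] x < x
      · refine Or.inr ⟨m + 1, by omega, le_rfl, fun r' h h' => hall r' h (by omega), _, h1,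
          Or.inl rfl, ?_⟩
        rw [hlt h1]
        rfl
      by_cases h2 : F'^[m + 1] x < x
      · refine Or.inr ⟨m + 1, by omega, le_rfl, fun r' h h' => hall r' h (by omega), _, h2,
          Or.inr rfl, ?_⟩
        rw [hge h1, hlt h2]
        rfl
      · refine Or.inl ⟨by rw [hge h1, hge h2]; rfl, fun r hr hrm => ?_⟩
        rcases Nat.le_succ_iff.1 hrm with hrm | rfl
        · exact hall r hr hrm
        · exact ⟨not_lt.1 h1, not_lt.1 h2⟩
    · refine Or.inr ⟨r, hr1, by omega, hmin, y, hy, hyr, ?_⟩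
      rw [hsucc, hs]
      rfl

theorem nearestColor_spec (x : ℕ) :
    (∀ r, 1 ≤ r → r ≤ x + 1 → x ≤ F^[r] x ∧ x ≤ F'^[r] x) ∨
    ∃ r, 1 ≤ r ∧ r ≤ x + 1 ∧ (∀ r', 1 ≤ r' → r' < r → x ≤ F^[r'] x ∧ x ≤ F'^[r'] x) ∧
      ∃ y < x, (y = F^[r] x ∨ y = F'^[r] x) ∧
        nearestColor F F' x = xor r.bodd (nearestColor F F' y) := by
  rcases scanColor_spec (F := F) (F' := F') x (x + 1) with h | ⟨r, h1, h2, h3, y, hy, hyr, hs⟩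
  · exact Or.inl h.2
  · exact Or.inr ⟨r, h1, h2, h3, y, hy, hyr, by rw [nearestColor, hs]; rfl⟩

end NearestColor

/-! ### Computable solutions on free computable actions. -/

section ComputableSide

theorem isComputableLabeling_of_fibers {X : Set ℕ} {Λ : Type} [Finite Λ] {f : X → Λ}
    (P : Λ → ℕ → Bool) (hP : ∀ a, Computable (P a)) (hf : ∀ (x : X) a, P a x = true ↔ f x = a) :
    IsComputableLabeling f := by
  obtain ⟨m, ⟨E⟩⟩ := Finite.exists_equiv_fin Λ
  let e : Λ ↪ ℕ := E.toEmbedding.trans Fin.valEmbedding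
  refine ⟨e, ?_⟩
  have key : ∀ l : List Λ, ∃ g : ℕ → ℕ, Computable g ∧ ∀ x : X, f x ∈ l → g x = e (f x) := by
    intro l
    induction l with
    | nil => exact ⟨fun _ => 0, Computable.const 0, fun x hx => absurd hx (by simp)⟩
    | cons a l ih =>
      obtain ⟨g, hg, hgf⟩ := ih
      refine ⟨fun x => bif P a x then e a else g x, (hP a).cond (Computable.const _) hg, ?_⟩
      intro x hx
      by_cases h : f x = a
      · simp [(hf x a).2 h, h]
      · have hfa : P a x = false := by simpa using mt (hf x a).1 h
        simp only [hfa, cond_false]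
        exact hgf x ((List.mem_cons.1 hx).resolve_left h)
  have := Fintype.ofFinite Λ
  obtain ⟨g, hg, hgf⟩ := key Finset.univ.toList
  exact ⟨g, hg, fun x => hgf x (by simp)⟩

/-- A bound for the values of `H` on `[0, m)`. -/
def strictBound (H : ℕ → ℕ) (m : ℕ) : ℕ := Nat.rec 0 (fun x acc => acc + (H x + 1)) m

theorem strictBound_eq_sum (H : ℕ → ℕ) (m : ℕ) :
    strictBound H m = ∑ x ∈ range m, (H x + 1) := by
  induction m with
  | zero => rfl
  | succ m ih => rw [sum_range_succ, ← ih]; rfl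

theorem lt_strictBound {H : ℕ → ℕ} {x m : ℕ} (hx : x < m) : H x < strictBound H m := by
  rw [strictBound_eq_sum]
  exact single_le_sum (f := fun x => H x + 1) (fun _ _ => Nat.zero_le _) (mem_range.2 hx)

theorem le_strictBound (H : ℕ → ℕ) (m : ℕ) : m ≤ strictBound H m := by
  rw [strictBound_eq_sum]
  calc m = ∑ x ∈ range m, 1 := by simp
    _ ≤ _ := sum_le_sum fun x _ => by omega

theorem computable_strictBound {H : ℕ → ℕ} (hH : Computable H) : Computable (strictBound H) := by
  have hadd : Computable₂ ((· + ·) : ℕ → ℕ → ℕ) := Primrec.nat_add.to_comp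
  exact Computable.nat_rec (f := id) (g := fun _ => 0) (h := fun _ p => p.2 + (H p.1 + 1))
    Computable.id (Computable.const 0)
    (hadd.comp (Computable.snd.comp Computable.snd)
      (Computable.succ.comp (hH.comp (Computable.fst.comp Computable.snd))))

theorem computable_filter_map {β : Type*} {g : β → ℕ → ℕ} (hg : ∀ s, Computable (g s))
    {p : ℕ → Bool} (hp : Computable p) (l : List β) :
    Computable (fun x => (l.map (fun s => g s x)).filter p) := by
  induction l with
  | nil => exact Computable.const []
  | cons s l ih =>
    refine (Computable.cond (hp.comp (hg s)) (Computable.list_cons.comp (hg s) ih) ih).of_eq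
      fun x => ?_
    rw [List.map_cons, List.filter_cons]
    cases p (g s x) <;> simp

variable {X : Set ℕ} [AddAction (ℤ × ℤ) X] {g : ℤ × ℤ → ℕ → ℕ}

theorem iterate_eq_vadd (hg : ∀ u (x : X), g u x = ((u +ᵥ x : X) : ℕ)) (u : ℤ × ℤ) (r : ℕ) (x : X) :
    (g u)^[r] x = (((r : ℤ) • u +ᵥ x : X) : ℕ) := by
  induction r with
  | zero => simp
  | succ r ih =>
    rw [Function.iterate_succ_apply', ih, hg, ← add_vadd]
    congr 2
    push_cast
    rw [add_smul, one_smul, add_comm]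

theorem rowsFollowNearestSmaller_nearestColor (hg : ∀ u (x : X), g u x = ((u +ᵥ x : X) : ℕ)) :
    RowsFollowNearestSmaller (fun x : X => (x : ℕ))
      (fun x : X => nearestColor (g (1, 0)) (g (-1, 0)) x) := by
  intro x i
  set y : X := ((i, 0) : ℤ × ℤ) +ᵥ x
  have hF : ∀ r : ℕ, (g (1, 0))^[r] y = ((((i + r, 0) : ℤ × ℤ) +ᵥ x : X) : ℕ) := by
    intro r
    rw [iterate_eq_vadd hg, ← add_vadd]
    congr 2
    ext <;> simp [add_comm]
  have hF' : ∀ r : ℕ, (g (-1, 0))^[r] y = ((((i - r, 0) : ℤ × ℤ) +ᵥ x : X) : ℕ) := by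
    intro r
    rw [iterate_eq_vadd hg, ← add_vadd]
    congr 2
    ext
    · simp; ring
    · simp
  have hcase : ∀ k : ℤ, k ≠ i → ∃ r : ℕ, 1 ≤ r ∧ (r : ℤ) = |k - i| ∧ (k = i + r ∨ k = i - r) := by
    intro k hk
    refine ⟨(k - i).natAbs, by omega, by simp, by omega⟩
  rcases nearestColor_spec (F := g (1, 0)) (F' := g (-1, 0)) (y : ℕ) with
    h | ⟨r, hr1, hrm, hmin, z, hz, hzr, hcol⟩
  · left
    intro k hk
    rcases eq_or_ne k i with rfl | hki
    · exact le_rfl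
    obtain ⟨r, hr1, hr, hkr⟩ := hcase k hki
    have := h r hr1 (by change |k - i| ≤ ((y : ℕ) : ℤ) + 1 at hk; omega)
    rw [hF, hF'] at this
    rcases hkr with rfl | rfl
    · exact this.1
    · exact this.2
  · right
    rw [hF, hF'] at hzr
    have hnear : ∀ l : ℤ, |l - i| < r → (y : ℕ) ≤ ((((l, 0) : ℤ × ℤ) +ᵥ x : X) : ℕ) := by
      intro l hl
      rcases eq_or_ne l i with rfl | hli
      · exact le_rfl
      obtain ⟨r', hr1', hr', hkr'⟩ := hcase l hli
      have := hmin r' hr1' (by omega)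
      rw [hF, hF'] at this
      rcases hkr' with rfl | rfl
      · exact this.1
      · exact this.2
    have hcol' : ∀ k : ℤ, k.bodd = xor i.bodd r.bodd →
        z = ((((k, 0) : ℤ × ℤ) +ᵥ x : X) : ℕ) →
        xor (nearestColor (g (1, 0)) (g (-1, 0)) y) i.bodd =
          xor (nearestColor (g (1, 0)) (g (-1, 0)) ((((k, 0) : ℤ × ℤ) +ᵥ x : X) : ℕ)) k.bodd := by
      intro k hk hzk
      rw [hcol, hk, hzk]
      cases i.bodd <;> cases r.bodd <;> simp
    rcases hzr with hzr | hzr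
    · have habs : |i + (r : ℤ) - i| = r := by simp
      refine ⟨i + r, by rw [habs]; change (r : ℤ) ≤ ((y : ℕ) : ℤ) + 1; omega,
        lt_of_eq_of_lt hzr.symm hz,
        hcol' _ (by simp [Int.bodd_add]) hzr, fun l hl => hnear l (by rwa [habs] at hl)⟩
    · have habs : |i - (r : ℤ) - i| = r := by simp
      refine ⟨i - r, by rw [habs]; change (r : ℤ) ≤ ((y : ℕ) : ℤ) + 1; omega,
        lt_of_eq_of_lt hzr.symm hz,
        hcol' _ (by simp [sub_eq_add_neg, Int.bodd_add, Int.bodd_neg]) hzr, fun l hl => hnear l (by rwa [habs] at hl)⟩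

/-- A bound for the images of a number under the unit translations. -/
def generatorSum (g : ℤ × ℤ → ℕ → ℕ) (x : ℕ) : ℕ :=
  (g (1, 0) x + g (-1, 0) x) + (g (0, 1) x + g (0, -1) x)

/-- Computability is given for each group element separately. Writing a translation as a product of
unit steps bounds all translations of a given length using four functions only. -/
theorem vadd_lt_iterate_strictBound (hg : ∀ u (x : X), g u x = ((u +ᵥ x : X) : ℕ))
    (p : ℕ) (u : ℤ × ℤ) (hu : u.1.natAbs + u.2.natAbs ≤ p) {m : ℕ} (x : X) (hx : (x : ℕ) < m) :
    ((u +ᵥ x : X) : ℕ) < (strictBound (generatorSum g))^[p] m := by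
  induction p generalizing u with
  | zero =>
    have : u = 0 := by
      ext
      · simp; omega
      · simp; omega
    simpa [this] using hx
  | succ p ih =>
    rw [Function.iterate_succ_apply']
    have hstep : ∀ e w : ℤ × ℤ, u = e + w → w.1.natAbs + w.2.natAbs ≤ p →
        (∀ x, g e x ≤ generatorSum g x) →
        ((u +ᵥ x : X) : ℕ) < strictBound (generatorSum g) ((strictBound (generatorSum g))^[p] m) := by
      rintro e w rfl hw he
      rw [add_vadd, ← hg]
      exact (he _).trans_lt (lt_strictBound (ih w hw))
    rcases lt_trichotomy u.1 0 with h | h | h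
    · exact hstep (-1, 0) (u.1 + 1, u.2) (by ext <;> simp) (by dsimp only; omega)
        (fun x => by rw [generatorSum]; omega)
    · rcases lt_trichotomy u.2 0 with h' | h' | h'
      · exact hstep (0, -1) (u.1, u.2 + 1) (by ext <;> simp) (by dsimp only; omega)
          (fun x => by rw [generatorSum]; omega)
      · exact lt_of_lt_of_le (ih u (by omega)) (le_strictBound _ _)
      · exact hstep (0, 1) (u.1, u.2 - 1) (by ext <;> simp) (by dsimp only; omega)
          (fun x => by rw [generatorSum]; omega)
    · exact hstep (1, 0) (u.1 - 1, u.2) (by ext <;> simp) (by dsimp only; omega)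
        (fun x => by rw [generatorSum]; omega)

theorem exists_computable_escape (hX : ComputablePred (fun m : ℕ => m ∈ X))
    (hfree : IsFreeAction (ℤ × ℤ) X) (hact : IsComputableAction (ℤ × ℤ) X) :
    ∃ (c : ℕ → Bool) (N : ℕ → ℕ), Computable c ∧ Computable N ∧ Function.Injective N ∧
      ∀ x : X, ∃ y ∈ escapeTargets (fun x : X => c x) x, N x = (y : ℕ) := by
  classical
  choose g hgc hg using hact
  set c : ℕ → Bool := nearestColor (g (1, 0)) (g (-1, 0)) with hcdef
  have hc : Computable c := computable_nearestColor (hgc _) (hgc _)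
  have hrows := rowsFollowNearestSmaller_nearestColor hg
  let p : ℕ → Bool := fun y => xor (c (g (1, 0) y)) (c y)
  have hp : Computable p := (Primrec.dom_bool₂ xor).to_comp.comp (hc.comp (hgc _)) hc
  -- Numbers outside `X` are matched to themselves, so that the matching problem lives on all of
  -- `ℕ`.
  let t : ℕ → List ℕ := fun x =>
    bif decide (x ∈ X) then (displacementBox.toList.map (fun s => g s x)).filter p else [x]
  have ht : Computable t := by
    refine Computable.cond ?_ (computable_filter_map hgc hp _)
      (Computable.list_cons.comp Computable.id (Computable.const []))
    obtain ⟨_, hdec⟩ := hX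
    convert hdec
  have htX : ∀ (x : X) (y : ℕ),
      y ∈ t x ↔ ∃ z ∈ escapeTargets (fun x : X => c x) x, (z : ℕ) = y := by
    intro x y
    have hpz : ∀ z : X, p z = true ↔ c ((((1, 0) : ℤ × ℤ) +ᵥ z : X) : ℕ) ≠ c z := by
      intro z
      simp only [p, hg]
      cases c ((((1, 0) : ℤ × ℤ) +ᵥ z : X) : ℕ) <;> cases c z <;> simp
    simp only [t, x.2, decide_true, cond_true, List.mem_filter, List.mem_map, Finset.mem_toList]
    constructor
    · rintro ⟨⟨s, hs, rfl⟩, hpy⟩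
      rw [hg] at hpy ⊢
      exact ⟨s +ᵥ x, mem_escapeTargets.2 ⟨⟨s, hs, rfl⟩, (hpz _).1 hpy⟩, rfl⟩
    · rintro ⟨z, hz, rfl⟩
      obtain ⟨⟨s, hs, rfl⟩, hz'⟩ := mem_escapeTargets.1 hz
      exact ⟨⟨s, hs, hg s x⟩, (hpz _).2 hz'⟩
  have htX' : ∀ x ∉ X, ∀ y, y ∈ t x ↔ y = x := by
    intro x hx y
    simp [t, hx]
  -- A displacement with both coordinates at most `k + 6` has at most `2 * k + 12` unit steps.
  let L : ℕ → ℕ := fun k => (strictBound (generatorSum g))^[2 * k + 12] k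
  have hL : Computable L := by
    have hadd : Computable₂ ((· + ·) : ℕ → ℕ → ℕ) := Primrec.nat_add.to_comp
    have hsum : Computable (generatorSum g) :=
      hadd.comp (hadd.comp (hgc _) (hgc _)) (hadd.comp (hgc _) (hgc _))
    exact Computable.nat_iterate (computable_strictBound hsum)
      (hadd.comp Primrec.nat_double.to_comp (Computable.const 12)) Computable.id
  have hball : ∀ (k : ℕ) (x : X), (x : ℕ) < k → ∀ u : ℤ × ℤ, |u.1| ≤ k + 6 → |u.2| ≤ k + 6 →
      ((u +ᵥ x : X) : ℕ) < L k := by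
    intro k x hx u h1 h2
    refine vadd_lt_iterate_strictBound hg _ u ?_ x hx
    rw [abs_le] at h1 h2
    omega
  have hglobal : ∀ NX : X → X, Function.Injective NX →
      (∀ x, NX x ∈ escapeTargets (fun x : X => c x) x) →
      ∃ N : ℕ → ℕ, Function.Injective N ∧ (∀ x, N x ∈ t x) ∧ (∀ x : X, N x = NX x) ∧
        ∀ x ∉ X, N x = x := by
    intro NX hNi hNt
    have e1 : ∀ x : X, (if h : (x : ℕ) ∈ X then ((NX ⟨x, h⟩ : X) : ℕ) else x) = NX x :=
      fun x => by simp
    have e2 : ∀ x ∉ X, (if h : x ∈ X then ((NX ⟨x, h⟩ : X) : ℕ) else x) = x :=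
      fun x hx => dif_neg hx
    refine ⟨fun x => if h : x ∈ X then (NX ⟨x, h⟩ : ℕ) else x, ?_, ?_, e1, e2⟩
    · intro x y hxy
      dsimp only at hxy
      split_ifs at hxy with hx hy hy
      · simpa using hNi (Subtype.ext hxy)
      · exact absurd (hxy ▸ (NX ⟨x, hx⟩).2) hy
      · exact absurd (hxy ▸ (NX ⟨y, hy⟩).2) hx
      · exact hxy
    · intro x
      by_cases hx : x ∈ X
      · have := e1 ⟨x, hx⟩
        dsimp only at this ⊢
        rw [this]
        exact (htX ⟨x, hx⟩ _).2 ⟨_, hNt _, rfl⟩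
      · dsimp only
        rw [e2 x hx]
        exact (htX' x hx x).2 rfl
  obtain ⟨N, hNc, hNi, hNt⟩ := exists_computable_matching ht hL
    (by
      -- With nothing prescribed, the extension statement is plain existence of a matching.
      obtain ⟨NX, hNi, hNt, -⟩ := exists_matching_extending (k := 0) (L := 0) (τ := id) hfree
        Subtype.val_injective hrows (fun x hx => absurd hx (by simp)) (fun x hx => absurd hx (by simp))
        (fun x hx => absurd hx (by simp))
      obtain ⟨N, hNi, hNt, -⟩ := hglobal NX hNi hNt
      exact ⟨N, hNi, hNt⟩)
    (by
      intro k τ hτ hτi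
      have hτX : ∀ x : X, ∃ z : X, (x : ℕ) < L k →
          z ∈ escapeTargets (fun x : X => c x) x ∧ (z : ℕ) = τ x := by
        intro x
        by_cases hx : (x : ℕ) < L k
        · obtain ⟨z, hz⟩ := (htX x _).1 (hτ x hx)
          exact ⟨z, fun _ => hz⟩
        · exact ⟨x, fun h => absurd h hx⟩
      choose τX hτX using hτX
      obtain ⟨NX, hNi, hNt, hNτ⟩ := exists_matching_extending (k := k) (L := L k) (τ := τX) hfree
        Subtype.val_injective hrows (hball k) (fun x hx => (hτX x hx).1)
        (fun x hx y hy hxy => Subtype.ext (hτi hx hy (by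
          rw [← (hτX x hx).2, ← (hτX y hy).2, hxy])))
      obtain ⟨N, hNi, hNt, hNX, hNX'⟩ := hglobal NX hNi hNt
      refine ⟨N, hNi, hNt, fun x hx => ?_⟩
      have hxL : x < L k := by
        have : ∀ r, k ≤ (strictBound (generatorSum g))^[r] k := fun r => by
          induction r with
          | zero => exact le_rfl
          | succ r ih =>
            rw [Function.iterate_succ_apply']
            exact ih.trans (le_strictBound _ _)
        exact lt_of_lt_of_le hx (this _)
      by_cases hxX : x ∈ X
      · rw [hNX ⟨x, hxX⟩, hNτ ⟨x, hxX⟩ hx]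
        exact (hτX ⟨x, hxX⟩ hxL).2
      · rw [hNX' x hxX, (htX' x hxX _).1 (hτ x hxL)])
  refine ⟨c, N, hc, hNc, hNi, fun x => ?_⟩
  obtain ⟨z, hz, hzN⟩ := (htX x _).1 (hNt x)
  exact ⟨z, hz, hzN.symm⟩

theorem escapeProblem_mem_COMPUTABLE {Γ : Type} [AddGroup Γ] (φ : ℤ × ℤ →+ Γ)
    (hφ : Function.Injective φ) : escapeProblem φ ∈ COMPUTABLE Γ := by
  intro X _ hX hfree hact
  let _ : AddAction (ℤ × ℤ) X := AddAction.compHom X φ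
  have hvadd : ∀ (u : ℤ × ℤ) (x : X), u +ᵥ x = φ u +ᵥ x := fun _ _ => rfl
  have hfree' : IsFreeAction (ℤ × ℤ) X := fun u x h =>
    (map_eq_zero_iff φ hφ).1 (hfree _ _ h)
  have hact' : IsComputableAction (ℤ × ℤ) X := fun u => hact (φ u)
  obtain ⟨c, N, hc, hNc, hNi, hN⟩ := exists_computable_escape hX hfree' hact'
  have hv : ∀ x : X, ∃ s : displacementBox, N x = ((φ (s : ℤ × ℤ) +ᵥ x : X) : ℕ) ∧
      c ((φ (1, 0) +ᵥ (φ (s : ℤ × ℤ) +ᵥ x) : X) : ℕ) ≠ c ((φ (s : ℤ × ℤ) +ᵥ x : X) : ℕ) := by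
    intro x
    obtain ⟨y, hy, hNy⟩ := hN x
    obtain ⟨⟨s, hs, rfl⟩, hcy⟩ := mem_escapeTargets.1 hy
    exact ⟨⟨s, hs⟩, hNy, hcy⟩
  choose v hvN hvc using hv
  refine ⟨fun x => ((c x, v x) : Bool × displacementBox), ?_, ?_⟩
  · refine (escapeProblem_isSolution_iff φ (fun x : X => c x) v).2 ⟨fun x y hxy => ?_, hvc⟩
    apply Subtype.ext
    apply hNi
    rw [hvN, hvN]
    exact congrArg Subtype.val hxy
  · choose g hgc hg using hact'
    -- By freeness the displacement is recovered from its endpoint: it is the only `s` in the box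
    -- with `g s x = N x`.
    refine isComputableLabeling_of_fibers (Λ := Bool × displacementBox)
      (fun a x => (c x == a.1) && (N x == g a.2 x)) (fun a => ?_) ?_
    · exact Primrec.and.to_comp.comp
        (Primrec.beq.to_comp.comp hc (Computable.const a.1))
        (Primrec.beq.to_comp.comp hNc (hgc _))
    · rintro x ⟨b, s⟩
      simp only [Bool.and_eq_true, beq_iff_eq, Prod.mk.injEq]
      refine and_congr_right fun _ => ?_
      rw [hvN, hg]
      constructor
      · intro h
        have h' : ((v x : ℤ × ℤ) +ᵥ x : X) = (s : ℤ × ℤ) +ᵥ x := Subtype.ext h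
        have h2 : (-(s : ℤ × ℤ) + v x) +ᵥ x = x := by rw [add_vadd, h', neg_vadd_vadd]
        exact Subtype.ext (neg_add_eq_zero.1 (hfree' _ _ h2)).symm
      · rintro rfl
        rfl

end ComputableSide

/-! ### Passage from the plane to `ℤⁿ`. -/

/-- The embedding of `ℤ²` into `ℤⁿ` as the first two coordinates. -/
def planeHom (n : ℕ) (hn : 2 ≤ n) : ℤ × ℤ →+ (Fin n → ℤ) :=
  (AddMonoidHom.single (fun _ : Fin n => ℤ) ⟨0, by omega⟩).coprod
    (AddMonoidHom.single (fun _ : Fin n => ℤ) ⟨1, by omega⟩)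

theorem planeHom_injective (n : ℕ) (hn : 2 ≤ n) : Function.Injective (planeHom n hn) := by
  intro u v h
  have h0 := congrFun h ⟨0, by omega⟩
  have h1 := congrFun h ⟨1, by omega⟩
  simp only [planeHom, AddMonoidHom.coprod_apply, AddMonoidHom.single_apply, Pi.add_apply,
    Pi.single_apply, Fin.mk.injEq, zero_ne_one, one_ne_zero, if_true, if_false, add_zero,
    zero_add] at h0 h1
  exact Prod.ext h0 h1

theorem theorem1p10 (n : ℕ) (hn : 2 ≤ n) :
    (COMPUTABLE (Fin n → ℤ) \ BAIRE (Fin n → ℤ)).Nonempty :=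
  ⟨escapeProblem (planeHom n hn), escapeProblem_mem_COMPUTABLE _ (planeHom_injective n hn),
    escapeProblem_notMem_BAIRE _ (planeHom_injective n hn)⟩
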